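/- **Theorem 1.6** (with its proposition form, Proposition 4.4). Let $a>0$ and let $v_0:\mathbb{R}^2\to(-\infty,0]$ be a bounded measurable radial function, not almost everywhere zero, supported in the disc of radius $a$ about the origin. For $x\in\mathbb{R}^2$ let $Ax=\tfrac12 e_3\wedge x=\tfrac12(-x_2,x_1)$, let $P=-i\nabla$, and for $\lambda>0$ consider on $L^2(\mathbb{R}^2)$ the magnetic Hamiltonian $$h^\lambda=(P-\lambda Ax)^2+\lambda^2v_0(x).$$ Suppose that $\varphi_0^\lambda$ is an $L^2$-normalized ground state of $h^\lambda$ (an eigenfunction whose eigenvalue is the bottom of the spectrum) and that it is radial. For $d\in\mathbb{R}^2$ define the magnetic hopping coefficient $$\rho^\lambda(d)=\lambda^2\int_{\mathbb{R}^2}\overline{\varphi_0^\lambda(x)}\,v_0(x)\,e^{i\lambda x\cdot Ad}\,\varphi_0^\lambda(x-d)\,dx .$$ There is a universal constant $C_\star>0$ (independent of $a,v_0,\lambda,\varphi_0^\lambda,d,x,\delta,\xi$) such that for all such $a$, $v_0$, all $\lambda>0$ and all such $\varphi_0^\lambda$: 1. if $|d|>2a$, then $\rho^\lambda(d)\neq0$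 and for every $x>1$ $$\left|\frac{\rho^\lambda(xd)}{\rho^\lambda(d)}\right|\le C_\star\exp\left(-\tfrac18\lambda(x^2-1)|d|^2\right);$$ 2. for all $\delta>2a$ and $\xi\ge0$, with $e_1=(1,0)$, $$|\rho^\lambda((\delta+\xi)e_1)|\le C_\star\,e^{-\frac18\lambda(\xi^2+2\delta\xi)}\,|\rho^\lambda(\delta e_1)| .$$ -/

import Mathlib

open MeasureTheory
open scoped ComplexConjugate ContDiff

noncomputable section

namespace MagneticWell

/-- The Euclidean plane. -/
abbrev Plane : Type := EuclideanSpace ℝ (Fin 2)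

/-- The coordinate unit vectors of the plane. -/
def unitVec (j : Fin 2) : Plane := EuclideanSpace.single j 1

/-- Symmetric-gauge vector potential of the unit magnetic field `e₃`:
`A x = (1/2) e₃ ∧ x = (1/2) (-x₂, x₁)`. -/
def vecPot (x : Plane) : Plane := !₂[-(x 1) / 2, x 0 / 2]

/-- Smooth compactly supported complex test functions on the plane. -/
def IsTest (χ : Plane → ℂ) : Prop := ContDiff ℝ ∞ χ ∧ HasCompactSupport χ

/-- The formal transpose of the `j`-th component of `P - b A`, `P = -i ∇`, for the bilinear pairing
`∫ u χ`: it sends `χ` to `i ∂ⱼ χ - b Aⱼ χ`. -/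
def transposeMomentum (b : ℝ) (j : Fin 2) (χ : Plane → ℂ) (x : Plane) : ℂ :=
  Complex.I * fderiv ℝ χ x (unitVec j) - ((b * vecPot x j : ℝ) : ℂ) * χ x

/-- `ψ` lies in the magnetic Sobolev space `H¹_A` (the form domain of the Hamiltonian) and
`g = (P - b A) ψ` in the sense of weak derivatives. -/
structure IsMagneticGradient (b : ℝ) (ψ : Plane → ℂ) (g : Fin 2 → Plane → ℂ) : Prop where
  memLp : MemLp ψ 2 volume
  memLp_grad : ∀ j, MemLp (g j) 2 volume
  weak : ∀ j χ, IsTest χ → ∫ x, g j x * χ x = ∫ x, ψ x * transposeMomentum b j χ x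

/-- `ψ` is in the domain of the one-well Hamiltonian `h = (P - b A)² + lam² v` and `h ψ = f`:
`ψ` has a weak magnetic gradient `g` in `L²`, the function `f` is in `L²`, and
`∑ⱼ (Pⱼ - b Aⱼ) gⱼ + lam² v ψ = f` weakly. -/
def HamiltonianEq (b lam : ℝ) (v : Plane → ℝ) (ψ f : Plane → ℂ) : Prop :=
  MemLp f 2 volume ∧ ∃ g, IsMagneticGradient b ψ g ∧ ∀ χ, IsTest χ →
    (∑ j, ∫ x, g j x * transposeMomentum b j χ x)
      + ∫ x, ((lam ^ 2 * v x : ℝ) : ℂ) * ψ x * χ x = ∫ x, f x * χ x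

/-- The quadratic form `‖(P - b A) ψ‖² + lam² ∫ v |ψ|²` of the one-well Hamiltonian, where
`g = (P - b A) ψ`. -/
def energy (lam : ℝ) (v : Plane → ℝ) (ψ : Plane → ℂ) (g : Fin 2 → Plane → ℂ) : ℝ :=
  (∑ j, ∫ x, ‖g j x‖ ^ 2) + lam ^ 2 * ∫ x, v x * ‖ψ x‖ ^ 2

/-- `(e, φ)` is an `L²`-normalized ground state eigenpair of `h = (P - b A)² + lam² v`:
`h φ = e φ`, `‖φ‖ = 1`, and `e` is the bottom of the spectrum of `h`, that is, the quadratic form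
of `h` is bounded below by `e ‖ψ‖²`. -/
structure IsGroundState (b lam : ℝ) (v : Plane → ℝ) (e : ℝ) (φ : Plane → ℂ) : Prop where
  eigen : HamiltonianEq b lam v φ (fun x => (e : ℂ) * φ x)
  normalized : ∫ x, ‖φ x‖ ^ 2 = 1
  lowest : ∀ ψ g, IsMagneticGradient b ψ g → e * ∫ x, ‖ψ x‖ ^ 2 ≤ energy lam v ψ g

/-- An `L²` function is radial if it agrees almost everywhere with a function of `|x|`. -/
def IsRadial (φ : Plane → ℂ) : Prop := ∃ f : ℝ → ℂ, ∀ᵐ x : Plane, φ x = f ‖x‖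

/-- Atomic wells: bounded, measurable, radial, non-positive, supported in the disc of radius `a`
about the origin, and with negative (essential) minimum, i.e. not almost everywhere zero. -/
structure IsAtomicWell (a : ℝ) (v : Plane → ℝ) : Prop where
  radius_pos : 0 < a
  measurable : Measurable v
  nonpos : ∀ x, v x ≤ 0
  bounded : ∃ M : ℝ, ∀ x, -M ≤ v x
  radial : ∃ w : ℝ → ℝ, ∀ x, v x = w ‖x‖
  support_subset : Function.support v ⊆ Metric.closedBall 0 a
  nontrivial : ¬ v =ᵐ[volume] 0

/-- The magnetic translate of `φ` by `d`: `φ_d(x) = exp(i x · b A d) φ(x - d)`. -/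
def magTranslate (b : ℝ) (φ : Plane → ℂ) (d x : Plane) : ℂ :=
  Complex.exp (Complex.I * ((b * inner ℝ x (vecPot d) : ℝ) : ℂ)) * φ (x - d)

/-- The magnetic hopping coefficient `⟨φ, lam² v φ_d⟩` in `L²`, conjugate-linear on the left. -/
def hopping (b lam : ℝ) (v : Plane → ℝ) (φ : Plane → ℂ) (d : Plane) : ℂ :=
  ∫ x, conj (φ x) * (((lam ^ 2 * v x : ℝ) : ℂ) * magTranslate b φ d x)

end MagneticWell

end

/-!
Write `s = |x|²`, `p(s) = exp (-lam s / 2)`. Since `e` is the bottom of the spectrum, testing the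
quadratic form with the Gaussian `exp (-lam |x|² / 4)` gives `e < lam`
(`IsGroundState.energy_lt`). A radial eigenfunction is `φ(x) = exp (-lam |x|² / 4) u(|x|²)`, where
`u` is a regular solution of `(s p u')' = V p u` with `V = (lam - e + lam² v) / 4`
(`IsGroundState.exists_profile`); outside the well `V` is the positive constant
`V₀ = (lam - e) / 4`. There the energy flux `Re (ū s p u')` is nondecreasing, and square
integrability forces it to be negative (`energyFlux_neg`). Hence `u` has no zeros outside the well
and `|u|` is nonincreasing there.

The magnetic translate of `φ` by `d` solves the magnetic equation without potential in the disc of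
radius `|d| - a > a` about the origin. Its means over centred circles therefore form a regular
solution `g` of the radial equation with `V₀` in place of `V`, and `g(0)` is determined by `φ(-d)`.
The hopping integral pairs the translate with a radial function, so that only `g` enters, and it
equals a multiple of `∫₀^{a²} (V - V₀) p ū g` (`hopping_eq_integral`).

* Two regular free solutions are proportional (`RadialSolution.proportional`), so `g` for different
  `d` differs only by the factor `φ(-d)`. Thus `ρ(d') / ρ(d) = φ(d') / φ(d)`, and the Gaussian
  factor of `φ` gives the decay, since `|u|` is nonincreasing.
* By Lagrange's identity (`RadialSolution.wronskian`) the integral is the Wronskian of `ū` and `g`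
  at `s = a²`. If it vanished, `u` would have the energy flux of a regular free solution, up to a
  nonnegative factor, and this is nonnegative; but the flux of `u` is negative. Hence `ρ(d) ≠ 0`.

This gives the estimate with constant one and with the rate `1 / 4` instead of `1 / 8`
(`hopping_decay`). Regularity of weak solutions is obtained in one variable, from the
du Bois-Reymond lemma (`exists_radialSolution`). The test functions there need not vanish at the
origin, which is how the regularity of the solution at `s = 0` is recorded.
-/

namespace MagneticWell

open Set Filter Topology

/-! ### Absolutely continuous primitives -/

/-- Integration by parts for two merely integrable functions, by Fubini on the two triangles of the
square. -/
theorem intervalIntegral_mul_primitive_add {a b : ℝ} (hab : a ≤ b) {f g : ℝ → ℂ}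
    (hf : IntervalIntegrable f volume a b) (hg : IntervalIntegrable g volume a b) :
    (∫ x in a..b, f x * ∫ y in a..x, g y) + (∫ x in a..b, (∫ y in a..x, f y) * g x)
      = (∫ x in a..b, f x) * ∫ x in a..b, g x := by
  set μ : Measure ℝ := volume.restrict (Ioc a b) with hμ
  have hf' : Integrable f μ := (intervalIntegrable_iff_integrableOn_Ioc_of_le hab).1 hf
  have hg' : Integrable g μ := (intervalIntegrable_iff_integrableOn_Ioc_of_le hab).1 hg
  have hfg : Integrable (fun z : ℝ × ℝ => f z.1 * g z.2) (μ.prod μ) := hf'.mul_prod hg'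
  set T : Set (ℝ × ℝ) := {z | z.2 ≤ z.1}
  have hTm : MeasurableSet T := measurableSet_le measurable_snd measurable_fst
  have key : ∀ (k : ℝ → ℂ) (x : ℝ), x ∈ Ioc a b →
      ∫ y, (Iic x).indicator k y ∂μ = ∫ y in a..x, k y := by
    intro k x hx
    rw [integral_indicator measurableSet_Iic, hμ, Measure.restrict_restrict measurableSet_Iic,
      intervalIntegral.integral_of_le hx.1.le]
    congr 2
    ext y; simp only [mem_inter_iff, mem_Iic, mem_Ioc]
    constructor
    · rintro ⟨h1, h2, h3⟩; exact ⟨h2, h1⟩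
    · rintro ⟨h1, h2⟩; exact ⟨h2, h1, h2.trans hx.2⟩
  have h1 : ∫ z, T.indicator (fun z : ℝ × ℝ => f z.1 * g z.2) z ∂(μ.prod μ)
      = ∫ x in a..b, f x * ∫ y in a..x, g y := by
    rw [integral_prod _ (hfg.indicator hTm), intervalIntegral.integral_of_le hab]
    refine setIntegral_congr_fun measurableSet_Ioc fun x hx => ?_
    rw [← key g x hx, ← integral_const_mul]
    congr 1; ext y
    by_cases h : y ≤ x <;> simp [T, indicator, h]
  have h2 : ∫ z, Tᶜ.indicator (fun z : ℝ × ℝ => f z.1 * g z.2) z ∂(μ.prod μ)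
      = ∫ x in a..b, (∫ y in a..x, f y) * g x := by
    rw [integral_prod_symm _ (hfg.indicator hTm.compl), intervalIntegral.integral_of_le hab]
    refine setIntegral_congr_fun measurableSet_Ioc fun x hx => ?_
    rw [← key f x hx, ← integral_mul_const]
    have hne : ∀ᵐ y ∂μ, y ≠ x := by
      rw [ae_iff]; simp [hμ]
    refine integral_congr_ae ?_
    filter_upwards [hne] with y hy
    by_cases h : y ≤ x
    · have : y < x := lt_of_le_of_ne h hy
      simp [T, indicator, h, this]
    · have : ¬ y < x := fun h' => h h'.le
      simp [T, indicator, h, this]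
  rw [← h1, ← h2, ← integral_add (hfg.indicator hTm) (hfg.indicator hTm.compl),
    intervalIntegral.integral_of_le hab, intervalIntegral.integral_of_le hab]
  rw [← integral_prod_mul]
  congr 1; ext z
  exact congrFun (indicator_self_add_compl T _) z

/-- `F` is a primitive of the integrable function `f` on `[a, b]`: the absolutely continuous
calculus used throughout, where `f` need not be continuous. -/
structure IsPrimitiveOn {E : Type*} [NormedAddCommGroup E] [NormedSpace ℝ E]
    (F f : ℝ → E) (a b : ℝ) : Prop where
  le : a ≤ b
  integrable : IntervalIntegrable f volume a b
  eq : ∀ x ∈ Icc a b, F x = F a + ∫ y in a..x, f y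

namespace IsPrimitiveOn
variable {E : Type*} [NormedAddCommGroup E] [NormedSpace ℝ E] {F f : ℝ → E} {a b : ℝ}

theorem sub_eq (h : IsPrimitiveOn F f a b) : F b - F a = ∫ y in a..b, f y := by
  rw [h.eq b ⟨h.le, le_rfl⟩]; abel

theorem mono (h : IsPrimitiveOn F f a b) {c d : ℝ} (hc : a ≤ c) (hcd : c ≤ d) (hd : d ≤ b) :
    IsPrimitiveOn F f c d := by
  have hi : ∀ x y, a ≤ x → x ≤ y → y ≤ b → IntervalIntegrable f volume x y := by
    intro x y h1 h2 h3
    refine h.integrable.mono_set ?_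
    rw [uIcc_of_le h2, uIcc_of_le h.le]
    exact Icc_subset_Icc h1 h3
  refine ⟨hcd, hi c d hc hcd hd, fun x hx => ?_⟩
  rw [h.eq x ⟨hc.trans hx.1, hx.2.trans hd⟩, h.eq c ⟨hc, hcd.trans hd⟩, add_assoc,
    intervalIntegral.integral_add_adjacent_intervals (hi a c le_rfl hc (hcd.trans hd))
      (hi c x hc hx.1 (hx.2.trans hd))]

theorem continuousOn (h : IsPrimitiveOn F f a b) : ContinuousOn F (Icc a b) := by
  have h1 : ContinuousOn (fun x => F a + ∫ y in a..x, f y) (Icc a b) := by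
    have := intervalIntegral.continuousOn_primitive_interval (μ := volume) (f := f) (a := a) (b := b)
      (by rw [uIcc_of_le h.le]
          exact (intervalIntegrable_iff_integrableOn_Icc_of_le h.le).1 h.integrable)
    rw [uIcc_of_le h.le] at this
    exact continuousOn_const.add this
  exact h1.congr h.eq

theorem clm {E' : Type*} [NormedAddCommGroup E'] [NormedSpace ℝ E'] [CompleteSpace E]
    [CompleteSpace E'] (L : E →L[ℝ] E')
    (h : IsPrimitiveOn F f a b) : IsPrimitiveOn (fun x => L (F x)) (fun x => L (f x)) a b := by
  have hi : ∀ x ∈ Icc a b, IntervalIntegrable f volume a x := fun x hx =>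
    (h.mono le_rfl hx.1 hx.2).integrable
  refine ⟨h.le, ⟨L.integrable_comp h.integrable.1, L.integrable_comp h.integrable.2⟩,
    fun x hx => ?_⟩
  rw [h.eq x hx, map_add, ContinuousLinearMap.intervalIntegral_comp_comm L (hi x hx)]

theorem mul {F f G g : ℝ → ℂ} (hF : IsPrimitiveOn F f a b) (hG : IsPrimitiveOn G g a b) :
    IsPrimitiveOn (fun x => F x * G x) (fun x => f x * G x + F x * g x) a b := by
  have iI : ∀ {k K : ℝ → ℂ}, IntervalIntegrable k volume a b → ContinuousOn K (Icc a b) →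
      IntervalIntegrable (fun x => k x * K x) volume a b := fun hk hK =>
    hk.mul_continuousOn (by rwa [uIcc_of_le hF.le])
  have i1 := iI hF.integrable hG.continuousOn
  have i2 := iI hG.integrable hF.continuousOn
  have i2' : IntervalIntegrable (fun x => F x * g x) volume a b := by
    simpa only [mul_comm] using i2
  refine ⟨hF.le, i1.add i2', fun x hx => ?_⟩
  have hF' := hF.mono le_rfl hx.1 hx.2
  have hG' := hG.mono le_rfl hx.1 hx.2
  have sub : ∀ {k : ℝ → ℂ}, IntervalIntegrable k volume a b → IntervalIntegrable k volume a x :=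
    fun hk => hk.mono_set (by
      rw [uIcc_of_le hx.1, uIcc_of_le hF.le]; exact Icc_subset_Icc le_rfl hx.2)
  have key := intervalIntegral_mul_primitive_add hx.1 hF'.integrable hG'.integrable
  have e1 : ∫ y in a..x, f y * G y = G a * (∫ y in a..x, f y)
      + ∫ y in a..x, f y * ∫ z in a..y, g z := by
    have ia : IntervalIntegrable (fun y => f y * ∫ z in a..y, g z) volume a x := by
      have : ContinuousOn (fun y => G y - G a) (Icc a b) := hG.continuousOn.sub continuousOn_const
      refine (sub (iI hF.integrable this)).congr ?_
      rw [uIoc_of_le hx.1]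
      intro y hy
      simp only
      rw [hG.eq y ⟨hy.1.le, hy.2.trans hx.2⟩]; ring
    rw [← intervalIntegral.integral_const_mul, ← intervalIntegral.integral_add
      ((hF'.integrable).const_mul _) ia]
    refine intervalIntegral.integral_congr fun y hy => ?_
    rw [uIcc_of_le hx.1] at hy
    rw [hG.eq y ⟨hy.1, hy.2.trans hx.2⟩]; ring
  have e2 : ∫ y in a..x, F y * g y = F a * (∫ y in a..x, g y)
      + ∫ y in a..x, (∫ z in a..y, f z) * g y := by
    have ia : IntervalIntegrable (fun y => (∫ z in a..y, f z) * g y) volume a x := by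
      have : ContinuousOn (fun y => F y - F a) (Icc a b) := hF.continuousOn.sub continuousOn_const
      refine (sub (iI hG.integrable this)).congr ?_
      rw [uIoc_of_le hx.1]
      intro y hy
      simp only
      rw [hF.eq y ⟨hy.1.le, hy.2.trans hx.2⟩]; ring
    rw [← intervalIntegral.integral_const_mul, ← intervalIntegral.integral_add
      ((hG'.integrable).const_mul _) ia]
    refine intervalIntegral.integral_congr fun y hy => ?_
    rw [uIcc_of_le hx.1] at hy
    rw [hF.eq y ⟨hy.1, hy.2.trans hx.2⟩]; ring
  rw [intervalIntegral.integral_add (sub i1) (sub i2'), e1, e2, hF.eq x hx, hG.eq x hx]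
  linear_combination -key

theorem conjugate {F f : ℝ → ℂ} (h : IsPrimitiveOn F f a b) :
    IsPrimitiveOn (fun x => conj (F x)) (fun x => conj (f x)) a b :=
  h.clm (Complex.conjCLE : ℂ →L[ℝ] ℂ)

theorem re {F f : ℝ → ℂ} (h : IsPrimitiveOn F f a b) :
    IsPrimitiveOn (fun x => (F x).re) (fun x => (f x).re) a b := h.clm Complex.reCLM

end IsPrimitiveOn

/-! ### Regular solutions of the radial equation -/

/-- The Gaussian weight `exp (-lam s / 2)`, that is `exp (-lam |x|² / 2)` in the variable
`s = |x|²`. -/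
noncomputable def gaussWeight (lam s : ℝ) : ℝ := Real.exp (-(lam * s / 2))

theorem gaussWeight_pos (lam s : ℝ) : 0 < gaussWeight lam s := Real.exp_pos _

theorem contDiff_gaussWeight (lam : ℝ) : ContDiff ℝ ∞ (gaussWeight lam) := by
  unfold gaussWeight; fun_prop

theorem continuous_gaussWeight (lam : ℝ) : Continuous (gaussWeight lam) :=
  (contDiff_gaussWeight lam).continuous

theorem gaussWeight_anti {lam : ℝ} (hl : 0 ≤ lam) : Antitone (gaussWeight lam) := by
  intro s t h
  unfold gaussWeight
  have := mul_le_mul_of_nonneg_left h hl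
  exact Real.exp_le_exp.2 (by linarith)

theorem mul_gaussWeight_pos {lam t : ℝ} (ht : 0 < t) : 0 < t * gaussWeight lam t :=
  mul_pos ht (gaussWeight_pos _ _)

/-- Solutions on `[0, S]` of the radial equation `(s p u')' = V p u`, `p = gaussWeight lam`, that
are regular at the origin, written as a first-order system for `u` and the flux `Q = s p u'`. -/
structure RadialSolution (lam : ℝ) (V : ℝ → ℝ) (S : ℝ) (u Q : ℝ → ℂ) : Prop where
  flux_zero : Q 0 = 0
  flux : IsPrimitiveOn Q (fun t => ((V t * gaussWeight lam t : ℝ) : ℂ) * u t) 0 S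
  value : IsPrimitiveOn u (fun t => Q t / ((t * gaussWeight lam t : ℝ) : ℂ)) 0 S

theorem IsPrimitiveOn.hasDerivAt {F f : ℝ → ℂ} {a b x : ℝ} (h : IsPrimitiveOn F f a b)
    (hx : x ∈ Ioo a b) (hf : ContinuousOn f (Ioo a b)) : HasDerivAt F (f x) x := by
  have hn : Ioo a b ∈ 𝓝 x := isOpen_Ioo.mem_nhds hx
  have h1 : HasDerivAt (fun y => ∫ t in a..y, f t) (f x) x :=
    intervalIntegral.integral_hasDerivAt_right (h.mono le_rfl hx.1.le hx.2.le).integrable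
      (hf.stronglyMeasurableAtFilter isOpen_Ioo x hx) (hf.continuousAt hn)
  refine (h1.const_add (F a)).congr_of_eventuallyEq ?_
  filter_upwards [hn] with y hy
  exact h.eq y ⟨hy.1.le, hy.2.le⟩

/-- Backward Grönwall inequality in integral form. -/
theorem eq_zero_of_le_integral {N : ℝ → ℝ} {a b C : ℝ} (hN : ContinuousOn N (Icc a b))
    (h0 : ∀ s ∈ Icc a b, 0 ≤ N s) (h : ∀ s ∈ Icc a b, N s ≤ C * ∫ t in s..b, N t) :
    ∀ s ∈ Icc a b, N s = 0 := by
  intro s hs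
  have hab : a ≤ b := hs.1.trans hs.2
  have hii : ∀ x ∈ Icc a b, ∀ y ∈ Icc a b, IntervalIntegrable N volume x y := fun x hx y hy =>
    (hN.mono (uIcc_subset_Icc hx hy)).intervalIntegrable
  have hb : b ∈ Icc a b := ⟨hab, le_rfl⟩
  set H : ℝ → ℝ := fun x => (∫ t in x..b, N t) * Real.exp (C * x) with hH
  have hHc : ContinuousOn H (Icc a b) := by
    refine ContinuousOn.mul ?_ (by fun_prop)
    have h1 : ContinuousOn (fun x => (∫ t in a..b, N t) - ∫ t in a..x, N t) (Icc a b) := by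
      have := intervalIntegral.continuousOn_primitive_interval (μ := volume) (f := N) (a := a)
        (b := b) (by rw [uIcc_of_le hab]; exact hN.integrableOn_Icc)
      rw [uIcc_of_le hab] at this
      exact continuousOn_const.sub this
    refine h1.congr fun x hx => ?_
    have := intervalIntegral.integral_add_adjacent_intervals
      (hii a ⟨le_rfl, hab⟩ x hx) (hii x hx b hb)
    simp only
    linarith
  have hHd : ∀ x ∈ Ioo a b, HasDerivAt H
      (-N x * Real.exp (C * x) + (∫ t in x..b, N t) * (Real.exp (C * x) * C)) x := by
    intro x hx
    have hn : Icc a b ∈ 𝓝 x := Icc_mem_nhds hx.1 hx.2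
    have h1 : HasDerivAt (fun y => ∫ t in y..b, N t) (-N x) x :=
      intervalIntegral.integral_hasDerivAt_left (hii x ⟨hx.1.le, hx.2.le⟩ b hb)
        ((hN.mono Ioo_subset_Icc_self).stronglyMeasurableAtFilter isOpen_Ioo x hx)
        (hN.continuousAt hn)
    have h2 : HasDerivAt (fun y => Real.exp (C * y)) (Real.exp (C * x) * C) x := by
      simpa using ((hasDerivAt_id x).const_mul C).exp
    exact h1.mul h2
  have hmono : MonotoneOn H (Icc a b) := by
    refine monotoneOn_of_deriv_nonneg (convex_Icc a b) hHc ?_ ?_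
    · rw [interior_Icc]
      exact fun x hx => (hHd x hx).differentiableAt.differentiableWithinAt
    · rw [interior_Icc]
      intro x hx
      rw [(hHd x hx).deriv]
      have := h x ⟨hx.1.le, hx.2.le⟩
      have he := Real.exp_pos (C * x)
      nlinarith
  have h1 : H s ≤ 0 := by simpa [hH] using hmono hs hb hs.2
  have h2 : 0 ≤ ∫ t in s..b, N t :=
    intervalIntegral.integral_nonneg hs.2 fun t ht => h0 t ⟨hs.1.trans ht.1, ht.2⟩
  have h3 : ∫ t in s..b, N t = 0 := by
    have he := Real.exp_pos (C * s)
    have : (∫ t in s..b, N t) ≤ 0 := by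
      by_contra hc
      push Not at hc
      exact absurd h1 (not_le.2 (mul_pos hc he))
    linarith
  have := h s hs
  rw [h3, mul_zero] at this
  exact le_antisymm this (h0 s hs)

namespace RadialSolution

variable {lam S : ℝ} {V : ℝ → ℝ} {u Q : ℝ → ℂ}

theorem mono (h : RadialSolution lam V S u Q) {T : ℝ} (hT : 0 ≤ T) (hTS : T ≤ S) :
    RadialSolution lam V T u Q :=
  ⟨h.flux_zero, h.flux.mono le_rfl hT hTS, h.value.mono le_rfl hT hTS⟩

theorem continuousOn_value_deriv (h : RadialSolution lam V S u Q) :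
    ContinuousOn (fun t => Q t / ((t * gaussWeight lam t : ℝ) : ℂ)) (Ioc 0 S) := by
  refine (h.flux.continuousOn.mono Ioc_subset_Icc_self).div ?_ ?_
  · have := continuous_gaussWeight lam
    fun_prop
  · intro t ht
    exact_mod_cast (mul_gaussWeight_pos ht.1).ne'

/-- The energy flux `Re (ū Q)` has derivative `|Q|² / (s p) + V p |u|²`, so it is nondecreasing where
`V` is nonnegative. -/
theorem isPrimitiveOn_energyFlux (h : RadialSolution lam V S u Q) :
    IsPrimitiveOn (fun s => (conj (u s) * Q s).re)
      (fun t => ‖Q t‖ ^ 2 / (t * gaussWeight lam t) + V t * gaussWeight lam t * ‖u t‖ ^ 2) 0 S := by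
  have := (h.value.conjugate.mul h.flux).re
  convert! this using 2 with t
  rw [map_div₀, Complex.conj_ofReal, div_mul_eq_mul_div, mul_comm (conj (Q t)), Complex.mul_conj,
    mul_left_comm, mul_comm (conj (u t)), Complex.mul_conj, Complex.normSq_eq_norm_sq,
    Complex.normSq_eq_norm_sq]
  norm_cast

theorem isPrimitiveOn_normSq (h : RadialSolution lam V S u Q) :
    IsPrimitiveOn (fun s => ‖u s‖ ^ 2)
      (fun t => 2 * (conj (u t) * Q t).re / (t * gaussWeight lam t)) 0 S := by
  have := (h.value.conjugate.mul h.value).re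
  convert! this using 2 with t t
  · rw [mul_comm, Complex.mul_conj, Complex.normSq_eq_norm_sq]; norm_cast
  · rw [map_div₀, Complex.conj_ofReal, div_mul_eq_mul_div, mul_div_assoc', ← add_div,
      Complex.div_ofReal_re]
    congr 1
    simp [Complex.add_re, Complex.mul_re]
    ring

theorem energyFlux_le (h : RadialSolution lam V S u Q) {s t : ℝ} (hs : 0 ≤ s) (hst : s ≤ t)
    (ht : t ≤ S) (hV : ∀ x ∈ Ioc s t, 0 ≤ V x) :
    (conj (u s) * Q s).re ≤ (conj (u t) * Q t).re := by
  have h1 := (h.isPrimitiveOn_energyFlux.mono hs hst ht).sub_eq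
  have h2 : 0 ≤ ∫ y in s..t, (‖Q y‖ ^ 2 / (y * gaussWeight lam y)
      + V y * gaussWeight lam y * ‖u y‖ ^ 2) := by
    rw [intervalIntegral.integral_of_le hst]
    refine setIntegral_nonneg measurableSet_Ioc fun y hy => ?_
    have := mul_gaussWeight_pos (lam := lam) (hs.trans_lt hy.1)
    have := gaussWeight_pos lam y
    have := hV y hy
    positivity
  linarith

theorem normSq_le (h : RadialSolution lam V S u Q) {s t : ℝ} (hs : 0 ≤ s) (hst : s ≤ t)
    (ht : t ≤ S) (hq : ∀ x ∈ Ioc s t, 0 ≤ (conj (u x) * Q x).re) : ‖u s‖ ^ 2 ≤ ‖u t‖ ^ 2 := by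
  have h1 := (h.isPrimitiveOn_normSq.mono hs hst ht).sub_eq
  have h2 : 0 ≤ ∫ y in s..t, 2 * (conj (u y) * Q y).re / (y * gaussWeight lam y) := by
    rw [intervalIntegral.integral_of_le hst]
    refine setIntegral_nonneg measurableSet_Ioc fun y hy => ?_
    have := mul_gaussWeight_pos (lam := lam) (hs.trans_lt hy.1)
    have := hq y hy
    positivity
  linarith

theorem normSq_ge (h : RadialSolution lam V S u Q) {s t : ℝ} (hs : 0 ≤ s) (hst : s ≤ t)
    (ht : t ≤ S) (hq : ∀ x ∈ Ioc s t, (conj (u x) * Q x).re ≤ 0) : ‖u t‖ ^ 2 ≤ ‖u s‖ ^ 2 := by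
  have h1 := (h.isPrimitiveOn_normSq.mono hs hst ht).sub_eq
  have h2 : ∫ y in s..t, 2 * (conj (u y) * Q y).re / (y * gaussWeight lam y) ≤ 0 := by
    rw [intervalIntegral.integral_of_le hst]
    refine setIntegral_nonpos measurableSet_Ioc fun y hy => ?_
    have := mul_gaussWeight_pos (lam := lam) (hs.trans_lt hy.1)
    exact div_nonpos_of_nonpos_of_nonneg (by linarith [hq y hy]) this.le
  linarith

theorem energyFlux_nonneg (h : RadialSolution lam V S u Q) (hV : ∀ x, 0 ≤ V x) {s : ℝ}
    (hs : s ∈ Icc 0 S) : 0 ≤ (conj (u s) * Q s).re := by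
  have := h.energyFlux_le le_rfl hs.1 hs.2 fun x _ => hV x
  simpa [h.flux_zero] using this

theorem ne_zero_of_nonneg (h : RadialSolution lam V S u Q) (hV : ∀ x, 0 ≤ V x) (h0 : u 0 ≠ 0)
    {s : ℝ} (hs : s ∈ Icc 0 S) : u s ≠ 0 := by
  have h1 := h.normSq_le le_rfl hs.1 hs.2 fun x hx =>
    h.energyFlux_nonneg hV ⟨hx.1.le, hx.2.trans hs.2⟩
  intro h2
  rw [h2, norm_zero] at h1
  have : 0 < ‖u 0‖ := norm_pos_iff.2 h0
  nlinarith

/-- Lagrange's identity: the Wronskian of two solutions of radial equations. -/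
theorem wronskian {V' : ℝ → ℝ} {g R : ℝ → ℂ} (h : RadialSolution lam V S u Q)
    (h' : RadialSolution lam V' S g R) :
    ∫ s in 0..S, (((V s - V' s) * gaussWeight lam s : ℝ) : ℂ) * (u s * g s)
      = Q S * g S - u S * R S := by
  have h1 := (h.flux.mul h'.value)
  have h2 := (h.value.mul h'.flux)
  have e1 := h1.sub_eq
  have e2 := h2.sub_eq
  simp only [h.flux_zero, h'.flux_zero, zero_mul, mul_zero, sub_zero] at e1 e2
  rw [e1, e2, ← intervalIntegral.integral_sub h1.integrable h2.integrable]
  congr 1; ext s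
  push_cast
  ring

/-- Two regular solutions of the same equation with nonnegative potential are proportional. -/
theorem proportional {g R : ℝ → ℂ} (hV : ∀ x, 0 ≤ V x) (h : RadialSolution lam V S u Q)
    (h' : RadialSolution lam V S g R) (h0 : g 0 ≠ 0) {s : ℝ} (hs : s ∈ Icc 0 S) :
    g 0 * u s = u 0 * g s := by
  have hg : ∀ t ∈ Icc 0 S, g t ≠ 0 := fun t ht => h'.ne_zero_of_nonneg hV h0 ht
  rcases eq_or_lt_of_le hs.1 with rfl | hs0
  · ring
  have hW : ∀ t ∈ Icc 0 S, Q t * g t - u t * R t = 0 := by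
    intro t ht
    rw [← (h.mono ht.1 ht.2).wronskian (h'.mono ht.1 ht.2)]
    simp
  have hc : ContinuousOn (fun t => u t / g t) (Icc 0 S) :=
    h.value.continuousOn.div h'.value.continuousOn hg
  have hd : ∀ t ∈ Ioo 0 S, HasDerivAt (fun t => u t / g t) 0 t := by
    intro t ht
    have d1 := h.value.hasDerivAt ht (h.continuousOn_value_deriv.mono Ioo_subset_Ioc_self)
    have d2 := h'.value.hasDerivAt ht (h'.continuousOn_value_deriv.mono Ioo_subset_Ioc_self)
    have ht' : t ∈ Icc 0 S := ⟨ht.1.le, ht.2.le⟩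
    convert! d1.div d2 (hg t ht') using 1
    rw [eq_comm, div_eq_zero_iff]
    left
    linear_combination (1 / ((t * gaussWeight lam t : ℝ) : ℂ)) * hW t ht'
  have hS : 0 < S := hs0.trans_le hs.2
  -- the quotient is constant on every compact subinterval of `(0, S)`, hence on `[0, S]`
  have hconst : u s / g s = u 0 / g 0 := by
    set k : ℝ → ℂ := fun t => u t / g t
    have hpre : ∀ x ∈ Ioo 0 S, ∀ y ∈ Ioo 0 S, k x = k y := by
      intro x hx y hy
      exact isOpen_Ioo.is_const_of_deriv_eq_zero isPreconnected_Ioo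
        (fun t ht => (hd t ht).differentiableAt.differentiableWithinAt)
        (fun t ht => (hd t ht).deriv) hx hy
    have hm : S / 2 ∈ Ioo 0 S := ⟨by linarith, by linarith⟩
    have hall : EqOn k (fun _ => k (S / 2)) (Icc 0 S) := by
      have : EqOn k (fun _ => k (S / 2)) (Ioo 0 S) := fun x hx => hpre x hx _ hm
      exact this.of_subset_closure hc continuousOn_const Ioo_subset_Icc_self
        (by rw [closure_Ioo hS.ne])
    have e1 := hall hs
    have e2 := hall ⟨le_rfl, hS.le⟩
    simp only at e1 e2
    exact e1.trans e2.symm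
  rw [div_eq_div_iff (hg s hs) h0] at hconst
  linear_combination hconst

/-- Unique continuation from the end point `S` down to the origin. -/
theorem eq_zero_of_end (h : RadialSolution lam V S u Q) {K : ℝ} (hK : ∀ x, |V x| ≤ K)
    (hl : 0 ≤ lam) (hu : u S = 0) (hQ : Q S = 0) {s : ℝ} (hs : s ∈ Ioc 0 S) : u s = 0 := by
  set N : ℝ → ℝ := fun t => ‖u t‖ + ‖Q t‖ with hN
  have hK0 : 0 ≤ K := (abs_nonneg _).trans (hK 0)
  set C : ℝ := K + 1 / (s * gaussWeight lam S) with hC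
  have hsp : 0 < s * gaussWeight lam S := mul_pos hs.1 (gaussWeight_pos _ _)
  have hsub : Icc s S ⊆ Icc 0 S := Icc_subset_Icc hs.1.le le_rfl
  have hcu := h.value.continuousOn.mono hsub
  have hcQ := h.flux.continuousOn.mono hsub
  have hNc : ContinuousOn N (Icc s S) := hcu.norm.add hcQ.norm
  have key := eq_zero_of_le_integral (C := C) hNc (fun t _ => by positivity) ?_ s ⟨le_rfl, hs.2⟩
  · have h1 : ‖u s‖ ≤ 0 := by
      have := norm_nonneg (Q s)
      simp only [hN] at key
      linarith
    exact norm_le_zero_iff.1 h1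
  intro t ht
  have ht0 : 0 ≤ t := hs.1.le.trans ht.1
  have e1 := (h.value.mono ht0 ht.2 le_rfl).sub_eq
  have e2 := (h.flux.mono ht0 ht.2 le_rfl).sub_eq
  rw [hu, zero_sub] at e1
  rw [hQ, zero_sub] at e2
  have hsubt : uIcc t S ⊆ Icc s S := by rw [uIcc_of_le ht.2]; exact Icc_subset_Icc ht.1 le_rfl
  have iu : IntervalIntegrable (fun x => ‖u x‖) volume t S :=
    (hcu.norm.mono hsubt).intervalIntegrable
  have iQ : IntervalIntegrable (fun x => ‖Q x‖) volume t S :=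
    (hcQ.norm.mono hsubt).intervalIntegrable
  have b1 : ‖u t‖ ≤ ∫ x in t..S, 1 / (s * gaussWeight lam S) * ‖Q x‖ := by
    rw [← norm_neg, e1]
    refine intervalIntegral.norm_integral_le_of_norm_le ht.2 (.of_forall fun x hx => ?_)
      (iQ.const_mul _)
    have hx0 : s < x := ht.1.trans_lt hx.1
    rw [norm_div, Complex.norm_real, Real.norm_of_nonneg
      (mul_gaussWeight_pos (hs.1.trans hx0)).le, one_div, inv_mul_eq_div]
    have := gaussWeight_anti hl hx.2
    have := gaussWeight_pos lam S
    have := hs.1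
    have := hs.1.trans hx0
    gcongr
  have b2 : ‖Q t‖ ≤ ∫ x in t..S, K * ‖u x‖ := by
    rw [← norm_neg, e2]
    refine intervalIntegral.norm_integral_le_of_norm_le ht.2 (.of_forall fun x hx => ?_)
      (iu.const_mul _)
    have hx0 : 0 < x := hs.1.trans (ht.1.trans_lt hx.1)
    rw [norm_mul, Complex.norm_real, norm_mul, Real.norm_eq_abs, Real.norm_of_nonneg
      (gaussWeight_pos _ _).le]
    have h1 : gaussWeight lam x ≤ 1 := by
      have := gaussWeight_anti hl hx0.le
      simpa [gaussWeight] using this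
    have h2 := mul_le_mul (hK x) h1 (gaussWeight_pos _ _).le hK0
    rw [mul_one] at h2
    gcongr
  rw [intervalIntegral.integral_const_mul] at b1 b2
  have n1 : 0 ≤ ∫ x in t..S, ‖u x‖ := intervalIntegral.integral_nonneg ht.2 fun _ _ => norm_nonneg _
  have n2 : 0 ≤ ∫ x in t..S, ‖Q x‖ := intervalIntegral.integral_nonneg ht.2 fun _ _ => norm_nonneg _
  have hi : ∫ x in t..S, N x = (∫ x in t..S, ‖u x‖) + ∫ x in t..S, ‖Q x‖ :=
    intervalIntegral.integral_add iu iQ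
  rw [hi, hC]
  have : 0 < 1 / (s * gaussWeight lam S) := by positivity
  simp only [hN]
  nlinarith [mul_nonneg hK0 n2, mul_nonneg this.le n1]

end RadialSolution

/-- A square integrable solution that does not vanish identically has negative energy flux
`Re (ū Q)` outside the well: otherwise `|u|` would be nondecreasing from some point on, forcing
`p |u|²` to decay no faster than `1 / s`. -/
theorem energyFlux_neg {lam V₀ K A : ℝ} {V : ℝ → ℝ} {u Q : ℝ → ℂ} (hl : 0 < lam)
    (hV₀ : 0 < V₀) (hA : 0 < A) (hV : ∀ s, A < s → V s = V₀) (hK : ∀ s, |V s| ≤ K)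
    (h : ∀ S, 0 ≤ S → RadialSolution lam V S u Q)
    (hint : IntegrableOn (fun s => gaussWeight lam s * ‖u s‖ ^ 2) (Ioi 0))
    (hne : ∃ s, 0 < s ∧ u s ≠ 0) {s : ℝ} (hs : A ≤ s) : (conj (u s) * Q s).re < 0 := by
  by_contra hq
  push Not at hq
  have hs0 : 0 < s := hA.trans_le hs
  have hqm : ∀ x y, s ≤ x → x ≤ y → (conj (u x) * Q x).re ≤ (conj (u y) * Q y).re := by
    intro x y hx hxy
    refine (h y (by linarith)).energyFlux_le (by linarith) hxy le_rfl fun z hz => ?_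
    rw [hV z (by linarith [hz.1])]; exact hV₀.le
  have hq0 : ∀ x, s ≤ x → 0 ≤ (conj (u x) * Q x).re := fun x hx => hq.trans (hqm s x le_rfl hx)
  have hum : ∀ x y, s ≤ x → x ≤ y → ‖u x‖ ^ 2 ≤ ‖u y‖ ^ 2 := by
    intro x y hx hxy
    exact (h y (by linarith)).normSq_le (by linarith) hxy le_rfl fun z hz =>
      hq0 z (by linarith [hz.1])
  by_cases hz : ∃ s₁, s ≤ s₁ ∧ u s₁ ≠ 0
  -- `|u|` is nondecreasing from `s₁` on, so the flux stays above `q₀ > 0`, and integrating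
  -- `(|u|²)' = 2 Re (ū Q) / (s p)` over `[x - 1, x]` bounds `p |u|²` below by a multiple of `1 / x`
  · obtain ⟨s₁, hs₁, hu₁⟩ := hz
    have hs₁0 : 0 < s₁ := by linarith
    set q₀ : ℝ := V₀ * gaussWeight lam (s₁ + 1) * ‖u s₁‖ ^ 2 with hq₀
    have hq₀pos : 0 < q₀ := by
      have := gaussWeight_pos lam (s₁ + 1)
      have := norm_pos_iff.2 hu₁
      positivity
    have hq1 : q₀ ≤ (conj (u (s₁ + 1)) * Q (s₁ + 1)).re := by
      have hp := ((h (s₁ + 1) (by linarith)).isPrimitiveOn_energyFlux.mono hs₁0.le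
        (by linarith) le_rfl)
      have e := hp.sub_eq
      have : ∫ _y in s₁..s₁ + 1, q₀ ≤ ∫ y in s₁..s₁ + 1, (‖Q y‖ ^ 2 / (y * gaussWeight lam y)
          + V y * gaussWeight lam y * ‖u y‖ ^ 2) := by
        refine intervalIntegral.integral_mono_on_of_le_Ioo (by linarith) (by simp) hp.integrable ?_
        intro y hy
        have hy0 : 0 < y := by linarith [hy.1]
        have g1 := mul_gaussWeight_pos (lam := lam) hy0
        have g2 := gaussWeight_anti hl.le hy.2.le
        have g3 := gaussWeight_pos lam (s₁ + 1)
        have g4 := hum s₁ y hs₁ hy.1.le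
        rw [hV y (by linarith [hy.1])]
        have g5 := gaussWeight_pos lam y
        have : q₀ ≤ V₀ * gaussWeight lam y * ‖u y‖ ^ 2 := by
          rw [hq₀]; gcongr
        have : 0 ≤ ‖Q y‖ ^ 2 / (y * gaussWeight lam y) := by positivity
        linarith
      simp only [intervalIntegral.integral_const, add_sub_cancel_left, one_smul] at this
      have := hq0 s₁ hs₁
      linarith
    set B : ℝ := s₁ + 2
    have hlow : ∀ x, B < x → 2 * q₀ * Real.exp (-(lam / 2)) * x⁻¹
        ≤ gaussWeight lam x * ‖u x‖ ^ 2 := by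
      intro x hx
      have hx1 : 0 < x - 1 := by linarith
      have hp := ((h x (by linarith)).isPrimitiveOn_normSq.mono hx1.le
        (by linarith) le_rfl)
      have e := hp.sub_eq
      have : ∫ _y in (x - 1)..x, (2 * q₀ / (x * gaussWeight lam (x - 1)))
          ≤ ∫ y in (x - 1)..x, 2 * (conj (u y) * Q y).re / (y * gaussWeight lam y) := by
        refine intervalIntegral.integral_mono_on_of_le_Ioo (by linarith) (by simp) hp.integrable ?_
        intro y hy
        have hy0 : 0 < y := by linarith [hy.1]
        have g1 := mul_gaussWeight_pos (lam := lam) hy0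
        have g2 := gaussWeight_anti hl.le hy.1.le
        have g3 := gaussWeight_pos lam y
        have g4 : q₀ ≤ (conj (u y) * Q y).re :=
          hq1.trans (hqm (s₁ + 1) y (by linarith) (by linarith [hy.1]))
        have g5 := hy.2.le
        have g6 := hq₀pos.trans_le g4
        have g7 := hy0.trans hy.2
        gcongr
      simp only [intervalIntegral.integral_const, sub_sub_cancel, one_smul] at this
      have h1 : 2 * q₀ / (x * gaussWeight lam (x - 1)) ≤ ‖u x‖ ^ 2 := by
        have := sq_nonneg ‖u (x - 1)‖
        linarith
      have h2 : gaussWeight lam x = Real.exp (-(lam / 2)) * gaussWeight lam (x - 1) := by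
        unfold gaussWeight
        rw [← Real.exp_add]; congr 1; ring
      calc 2 * q₀ * Real.exp (-(lam / 2)) * x⁻¹
          = gaussWeight lam x * (2 * q₀ / (x * gaussWeight lam (x - 1))) := by
            rw [h2]
            have := (gaussWeight_pos lam (x - 1)).ne'
            have hx0 : x ≠ 0 := by linarith
            field_simp
        _ ≤ _ := mul_le_mul_of_nonneg_left h1 (gaussWeight_pos _ _).le
    have hc : 0 < 2 * q₀ * Real.exp (-(lam / 2)) := by positivity
    have hB0 : 0 < B := by linarith
    have hi : IntegrableOn (fun x : ℝ => 2 * q₀ * Real.exp (-(lam / 2)) * x⁻¹) (Ioi B) := by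
      refine Integrable.mono' (hint.mono_set (Ioi_subset_Ioi hB0.le))
        (by fun_prop) ?_
      refine (ae_restrict_iff' measurableSet_Ioi).2 (.of_forall fun x hx => ?_)
      have hx0 : 0 < x := hB0.trans hx
      rw [Real.norm_of_nonneg (by positivity)]
      exact hlow x hx
    have hi2 : IntegrableOn (fun x : ℝ => x⁻¹) (Ioi B) := by
      have := hi.const_mul (2 * q₀ * Real.exp (-(lam / 2)))⁻¹
      refine this.congr (.of_forall fun x => ?_)
      simp only
      rw [inv_mul_cancel_left₀ hc.ne']
    exact not_integrableOn_Ioi_inv hi2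
  -- `u` vanishes beyond `s`, hence so does the constant flux there, and unique continuation applies
  · push Not at hz
    have hQc : ∀ x, s ≤ x → Q x = Q s := by
      intro x hx
      have e := ((h x (by linarith)).flux.mono hs0.le hx le_rfl).sub_eq
      rw [sub_eq_iff_eq_add] at e
      rw [e, intervalIntegral.integral_congr (g := fun _ => 0), intervalIntegral.integral_zero,
        zero_add]
      intro t ht
      rw [uIcc_of_le hx] at ht
      simp [hz t ht.1]
    have hp := (h (s + 1) (by linarith)).value.mono hs0.le (by linarith) le_rfl
    have e := hp.sub_eq
    have hpos : 0 < ∫ t in s..s + 1, (t * gaussWeight lam t)⁻¹ := by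
      refine intervalIntegral.intervalIntegral_pos_of_pos_on ?_ ?_ (by linarith)
      · refine ContinuousOn.intervalIntegrable ?_
        rw [uIcc_of_le (by linarith)]
        refine ContinuousOn.inv₀ ?_ ?_
        · exact (continuous_id.mul (continuous_gaussWeight lam)).continuousOn
        · exact fun t ht => (mul_gaussWeight_pos (hs0.trans_le ht.1)).ne'
      · exact fun t ht => inv_pos.2 (mul_gaussWeight_pos (hs0.trans ht.1))
    have hQ : Q s = 0 := by
      have : ∫ t in s..s + 1, Q t / ((t * gaussWeight lam t : ℝ) : ℂ)
          = Q s * ((∫ t in s..s + 1, (t * gaussWeight lam t)⁻¹ : ℝ) : ℂ) := by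
        rw [← intervalIntegral.integral_ofReal, ← intervalIntegral.integral_const_mul]
        refine intervalIntegral.integral_congr fun t ht => ?_
        rw [uIcc_of_le (by linarith)] at ht
        rw [hQc t ht.1, div_eq_mul_inv, Complex.ofReal_inv]
      rw [this, hz s le_rfl, hz (s + 1) (by linarith), sub_zero, eq_comm, mul_eq_zero] at e
      rcases e with e | e
      · exact e
      · exact absurd (by exact_mod_cast e) hpos.ne'
    obtain ⟨t, ht, hut⟩ := hne
    rcases le_total t s with hts | hts
    · exact hut ((h s hs0.le).eq_zero_of_end hK hl.le (hz s le_rfl) hQ ⟨ht, hts⟩)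
    · exact hut (hz t hts)

/-! ### Regularity of weak solutions in one variable -/

theorem IsPrimitiveOn.of_hasDerivAt {F f : ℝ → ℂ} {a b : ℝ} (hab : a ≤ b)
    (h : ∀ x, HasDerivAt F (f x) x) (hf : Continuous f) : IsPrimitiveOn F f a b := by
  refine ⟨hab, hf.intervalIntegrable _ _, fun x _ => ?_⟩
  rw [intervalIntegral.integral_eq_sub_of_hasDerivAt (fun y _ => h y) (hf.intervalIntegrable _ _)]
  ring

theorem integrable_smul_of_tsupport_subset {J : Set ℝ} {f : ℝ → ℂ} {ψ : ℝ → ℝ}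
    (hf : LocallyIntegrableOn f J) (hψ : Continuous ψ) (hc : HasCompactSupport ψ)
    (hs : tsupport ψ ⊆ J) : Integrable (fun x => ψ x • f x) := by
  have h1 : IntegrableOn f (tsupport ψ) := hf.integrableOn_compact_subset hs hc
  have h2 : IntegrableOn (fun x => ψ x • f x) (tsupport ψ) :=
    h1.continuousOn_smul hψ.continuousOn hc
  refine (integrableOn_iff_integrable_of_support_subset ?_).1 h2
  intro x hx
  refine subset_tsupport ψ ?_
  intro h
  exact hx (by simp [h])

theorem contDiff_primitive_and_deriv {k : ℝ → ℝ} (hk : ContDiff ℝ ∞ k) (m : ℝ) :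
    ContDiff ℝ ∞ (fun x => ∫ t in m..x, k t) ∧ deriv (fun x => ∫ t in m..x, k t) = k := by
  have hd : ∀ x, HasDerivAt (fun x => ∫ t in m..x, k t) (k x) x := fun x =>
    intervalIntegral.integral_hasDerivAt_right (hk.continuous.intervalIntegrable _ _)
      (hk.continuous.stronglyMeasurableAtFilter _ _) hk.continuous.continuousAt
  have he : deriv (fun x => ∫ t in m..x, k t) = k := funext fun x => (hd x).deriv
  refine ⟨contDiff_infty_iff_deriv.2 ⟨fun x => (hd x).differentiableAt, ?_⟩, he⟩
  rw [he]; exact hk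

/-- The du Bois-Reymond lemma: a locally integrable function on an open interval with vanishing
weak derivative is almost everywhere constant. -/
theorem ae_eq_const_of_integral_deriv_smul_eq_zero {J : Set ℝ} (hJ : IsOpen J)
    (hJc : J.OrdConnected) {f : ℝ → ℂ} (hf : LocallyIntegrableOn f J)
    (h : ∀ ζ : ℝ → ℝ, ContDiff ℝ ∞ ζ → HasCompactSupport ζ → tsupport ζ ⊆ J →
      ∫ x, deriv ζ x • f x = 0) : ∃ c : ℂ, ∀ᵐ x, x ∈ J → f x = c := by
  rcases J.eq_empty_or_nonempty with rfl | ⟨x₀, hx₀⟩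
  · exact ⟨0, by simp⟩
  obtain ⟨r, hr, hrJ⟩ := Metric.nhds_basis_closedBall.mem_iff.1 (hJ.mem_nhds hx₀)
  let β : ContDiffBump x₀ := ⟨r / 2, r, by positivity, by linarith⟩
  set b : ℝ → ℝ := β.normed volume
  have hbs : ContDiff ℝ ∞ b := β.contDiff_normed
  have hbt : tsupport b = Metric.closedBall x₀ r := β.tsupport_normed_eq
  have hbJ : tsupport b ⊆ J := hbt ▸ hrJ
  have hbc : HasCompactSupport b := β.hasCompactSupport_normed
  have hbi : ∫ x, b x = 1 := β.integral_normed
  -- the constant is the mean of `f` against a bump `b`, and `ψ - (∫ ψ) b` has a compactly supported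
  -- primitive
  refine ⟨∫ x, b x • f x, ?_⟩
  set c : ℂ := ∫ x, b x • f x with hc
  have hfc : LocallyIntegrableOn (fun x => f x - c) J :=
    hf.sub (continuousOn_const.locallyIntegrableOn hJ.measurableSet)
  have := hJ.ae_eq_zero_of_integral_contDiff_smul_eq_zero hfc ?_
  · filter_upwards [this] with x hx hxJ
    exact sub_eq_zero.1 (hx hxJ)
  intro ψ hψ hψc hψJ
  set I : ℝ := ∫ x, ψ x with hI
  set k : ℝ → ℝ := fun x => ψ x - I * b x with hk
  have hks : ContDiff ℝ ∞ k := hψ.sub (contDiff_const.mul hbs)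
  set K : Set ℝ := tsupport ψ ∪ tsupport b
  have hKc : IsCompact K := hψc.isCompact.union hbc.isCompact
  have hKne : K.Nonempty := ⟨x₀, Or.inr (by rw [hbt]; exact Metric.mem_closedBall_self hr.le)⟩
  have hKJ : K ⊆ J := union_subset hψJ hbJ
  set m := sInf K
  set M := sSup K
  have hmK : m ∈ K := hKc.sInf_mem hKne
  have hMK : M ∈ K := hKc.sSup_mem hKne
  have hmM : Icc m M ⊆ J := hJc.out (hKJ hmK) (hKJ hMK)
  have hk0 : ∀ x, x ∉ K → k x = 0 := by
    intro x hx
    have h1 : ψ x = 0 := image_eq_zero_of_notMem_tsupport fun h' => hx (Or.inl h')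
    have h2 : b x = 0 := image_eq_zero_of_notMem_tsupport fun h' => hx (Or.inr h')
    simp [hk, h1, h2]
  have hKI : K ⊆ Icc m M := fun x hx =>
    ⟨csInf_le hKc.bddBelow hx, le_csSup hKc.bddAbove hx⟩
  have hψi : Integrable ψ := hψ.continuous.integrable_of_hasCompactSupport hψc
  have hbi' : Integrable b := hbs.continuous.integrable_of_hasCompactSupport hbc
  have hki : ∫ x, k x = 0 := by
    simp only [hk]
    rw [integral_sub hψi (hbi'.const_mul I), integral_const_mul, hbi]
    simp [hI]
  obtain ⟨hζs, hζd⟩ := contDiff_primitive_and_deriv hks (m - 1)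
  set ζ : ℝ → ℝ := fun x => ∫ t in (m - 1)..x, k t with hζ
  have hζ0 : ∀ x, x ∉ Icc m M → ζ x = 0 := by
    intro x hx
    rcases lt_or_ge x m with hxm | hxm
    · simp only [hζ]
      rw [intervalIntegral.integral_congr (g := fun _ => 0), intervalIntegral.integral_zero]
      intro t ht
      refine hk0 t fun htK => ?_
      have h1 := (hKI htK).1
      have h2 := ht.2
      have h3 : (m - 1) ⊔ x < m := max_lt (by linarith) hxm
      linarith
    · have hMx : M < x := by
        by_contra hc; exact hx ⟨hxm, not_lt.1 hc⟩
      simp only [hζ]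
      rw [intervalIntegral.integral_eq_integral_of_support_subset, hki]
      intro t ht
      have htK : t ∈ K := by
        by_contra hc; exact ht (hk0 t hc)
      exact ⟨by linarith [(hKI htK).1], by linarith [(hKI htK).2]⟩
  have hζt : tsupport ζ ⊆ Icc m M :=
    closure_minimal (fun x hx => by by_contra hc; exact hx (hζ0 x hc)) isClosed_Icc
  have hζc : HasCompactSupport ζ := HasCompactSupport.of_support_subset_isCompact isCompact_Icc
    ((subset_tsupport ζ).trans hζt)
  have key := h ζ hζs hζc (hζt.trans hmM)
  rw [hζd] at key
  have i1 := integrable_smul_of_tsupport_subset hf hψ.continuous hψc hψJ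
  have i2 := integrable_smul_of_tsupport_subset hf hbs.continuous hbc hbJ
  have e1 : ∫ x, k x • f x = (∫ x, ψ x • f x) - I • c := by
    have i2' : Integrable (fun x => I • b x • f x) := i2.smul I
    rw [hc, ← integral_smul, ← integral_sub i1 i2']
    congr 1; ext x
    simp only [hk]
    rw [sub_smul, smul_smul]
  have e2 : ∫ x, ψ x • (f x - c) = (∫ x, ψ x • f x) - I • c := by
    have i3 : Integrable (fun x => ψ x • c) := hψi.smul_const c
    rw [hI, ← integral_smul_const, ← integral_sub i1 i3]
    congr 1; ext x
    rw [smul_sub]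
  rw [e2, ← e1, key]

/-- Regularity for the radial equation: an `L²` weak solution of `(s p U')' = V p U` on an initial
interval `J` of `(0, ∞)`, tested against functions `η` that need not vanish at the origin, agrees
almost everywhere with a regular solution. -/
theorem exists_radialSolution {lam K : ℝ} {J : Set ℝ} (hJ : IsOpen J) (hJ0 : J ⊆ Ioi 0)
    (hJl : ∀ s ∈ J, Ioc 0 s ⊆ J) {V : ℝ → ℝ} (hVm : Measurable V) (hVK : ∀ s, |V s| ≤ K)
    {U : ℝ → ℂ} (hU : ∀ s ∈ J, MemLp U 2 (volume.restrict (Ioc 0 s)))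
    (hweak : ∀ η : ℝ → ℝ, ContDiff ℝ ∞ η → (∃ M ∈ J, ∀ s, M ≤ s → η s = 0) →
      ∫ s in Ioi 0, U s * ((-deriv (fun s => s * gaussWeight lam s * deriv η s) s
        + V s * gaussWeight lam s * η s : ℝ) : ℂ) = 0) :
    ∃ u Q : ℝ → ℂ, (∀ᵐ s, s ∈ J → U s = u s) ∧ ∀ S ∈ J, RadialSolution lam V S u Q := by
  set f : ℝ → ℂ := fun t => ((V t * gaussWeight lam t : ℝ) : ℂ) * U t with hf
  set Q : ℝ → ℂ := fun s => ∫ t in 0..s, f t with hQ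
  set r : ℝ → ℂ := fun t => Q t / ((t * gaussWeight lam t : ℝ) : ℂ) with hr
  set R : ℝ → ℂ := fun s => ∫ t in 0..s, r t with hR
  have hpc := continuous_gaussWeight lam
  have hK0 : 0 ≤ K := (abs_nonneg _).trans (hVK 0)
  have hUi : ∀ s ∈ J, IntegrableOn U (Ioc 0 s) := fun s hs => (hU s hs).integrable (by norm_num)
  have hbp : ∀ s, 0 ≤ s → ∃ C, 0 < C ∧ ∀ t ∈ Icc 0 s, gaussWeight lam t ≤ C ∧
      C⁻¹ ≤ gaussWeight lam t := by
    intro s hs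
    obtain ⟨C₁, hC₁⟩ := isCompact_Icc.exists_bound_of_continuousOn
      (hpc.continuousOn (s := Icc 0 s))
    obtain ⟨C₂, hC₂⟩ := isCompact_Icc.exists_bound_of_continuousOn
      ((hpc.inv₀ fun t => (gaussWeight_pos lam t).ne').continuousOn (s := Icc 0 s))
    have h0 := hC₁ 0 ⟨le_rfl, hs⟩
    have hC1 : 0 < C₁ := (norm_pos_iff.2 (gaussWeight_pos lam 0).ne').trans_le h0
    refine ⟨max C₁ C₂, lt_max_of_lt_left hC1, fun t ht => ⟨?_, ?_⟩⟩
    · exact (le_abs_self _).trans ((hC₁ t ht).trans (le_max_left _ _))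
    · refine inv_le_of_inv_le₀ (gaussWeight_pos _ _) ?_
      exact (le_abs_self _).trans ((hC₂ t ht).trans (le_max_right _ _))
  have hfi : ∀ s ∈ J, IntegrableOn f (Ioc 0 s) := by
    intro s hs
    obtain ⟨C, hC, hCb⟩ := hbp s (hJ0 hs).le
    refine Integrable.bdd_mul (c := K * C) (hUi s hs)
      ((Complex.measurable_ofReal.comp (hVm.mul hpc.measurable)).aestronglyMeasurable) ?_
    refine (ae_restrict_iff' measurableSet_Ioc).2 (.of_forall fun t ht => ?_)
    rw [Complex.norm_real, norm_mul, Real.norm_eq_abs, Real.norm_of_nonneg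
      (gaussWeight_pos _ _).le]
    exact mul_le_mul (hVK t) (hCb t ⟨ht.1.le, ht.2⟩).1 (gaussWeight_pos _ _).le hK0
  have hfI : ∀ s ∈ J, IntervalIntegrable f volume 0 s := fun s hs =>
    (intervalIntegrable_iff_integrableOn_Ioc_of_le (hJ0 hs).le).2 (hfi s hs)
  have hQp : ∀ s ∈ J, IsPrimitiveOn Q f 0 s := fun s hs =>
    ⟨(hJ0 hs).le, hfI s hs, fun x _ => by simp [hQ]⟩
  -- the flux is `O(√s)` at the origin, by Cauchy-Schwarz, so `Q / (s p)` is integrable there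
  have hrI : ∀ s ∈ J, IntervalIntegrable r volume 0 s := by
    intro s hs
    have hs0 : 0 < s := hJ0 hs
    obtain ⟨C, hC, hCb⟩ := hbp s hs0.le
    set N : ℝ := ∫ t in Ioc 0 s, ‖U t‖ ^ 2
    have hU2 : IntegrableOn (fun t => ‖U t‖ ^ 2) (Ioc 0 s) :=
      (memLp_two_iff_integrable_sq_norm (hU s hs).1).1 (hU s hs)
    have hN0 : 0 ≤ N := integral_nonneg fun t => by positivity
    have hQb : ∀ t ∈ Ioc 0 s, ‖Q t‖ ≤ K * C * (N + 1) * Real.sqrt t := by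
      intro t ht
      have hrt : 0 < Real.sqrt t := Real.sqrt_pos.2 ht.1
      have hsub : Ioc 0 t ⊆ Ioc 0 s := Ioc_subset_Ioc_right ht.2
      have hb1 : IntegrableOn (fun x => K * C * (Real.sqrt t * ‖U x‖ ^ 2 + (Real.sqrt t)⁻¹))
          (Ioc 0 t) :=
        (((hU2.mono_set hsub).const_mul _).add (by simp)).const_mul _
      have h1 : ‖Q t‖ ≤ ∫ x in 0..t, K * C * (Real.sqrt t * ‖U x‖ ^ 2 + (Real.sqrt t)⁻¹) := by
        refine intervalIntegral.norm_integral_le_of_norm_le ht.1.le (.of_forall fun x hx => ?_)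
          ((intervalIntegrable_iff_integrableOn_Ioc_of_le ht.1.le).2 hb1)
        have hx' : x ∈ Icc 0 s := ⟨hx.1.le, hx.2.trans ht.2⟩
        rw [norm_mul, Complex.norm_real, norm_mul, Real.norm_eq_abs, Real.norm_of_nonneg
          (gaussWeight_pos _ _).le]
        have h2 := mul_le_mul (hVK x) (hCb x hx').1 (gaussWeight_pos _ _).le hK0
        have h3 : ‖U x‖ ≤ Real.sqrt t * ‖U x‖ ^ 2 + (Real.sqrt t)⁻¹ := by
          set y := Real.sqrt t
          have h4 : y * ‖U x‖ ^ 2 + y⁻¹ - ‖U x‖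
              = y⁻¹ * ((y * ‖U x‖ - 1 / 2) ^ 2 + 3 / 4) := by
            field_simp; ring
          have h5 : 0 ≤ y⁻¹ * ((y * ‖U x‖ - 1 / 2) ^ 2 + 3 / 4) := by positivity
          linarith
        exact mul_le_mul h2 h3 (norm_nonneg _) (by positivity)
      rw [intervalIntegral.integral_of_le ht.1.le, integral_const_mul,
        integral_add ((hU2.mono_set hsub).const_mul _) (by simp), integral_const_mul,
        setIntegral_const] at h1
      have h2 : ∫ x in Ioc 0 t, ‖U x‖ ^ 2 ≤ N :=
        setIntegral_mono_set hU2 (.of_forall fun x => by positivity) hsub.eventuallyLE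
      have h3 : volume.real (Ioc 0 t) • (Real.sqrt t)⁻¹ = Real.sqrt t := by
        simp only [Real.volume_real_Ioc, sub_zero, smul_eq_mul]
        rw [max_eq_left ht.1.le]
        nth_rewrite 1 [← Real.mul_self_sqrt ht.1.le]
        field_simp
      rw [h3] at h1
      refine h1.trans ?_
      have h4 : Real.sqrt t * (∫ x in Ioc 0 t, ‖U x‖ ^ 2) + Real.sqrt t
          ≤ (N + 1) * Real.sqrt t := by nlinarith
      have h5 : 0 ≤ K * C := by positivity
      nlinarith [mul_le_mul_of_nonneg_left h4 h5]
    have hdom : IntervalIntegrable (fun t : ℝ => K * C * (N + 1) * C * t ^ (-(1 / 2) : ℝ))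
        volume 0 s := (intervalIntegral.intervalIntegrable_rpow' (by norm_num)).const_mul _
    refine hdom.mono_fun ?_ ?_
    · rw [uIoc_of_le hs0.le]
      refine ContinuousOn.aestronglyMeasurable ?_ measurableSet_Ioc
      refine (((hQp s hs).continuousOn).mono Ioc_subset_Icc_self).div
        (by fun_prop) fun t ht => ?_
      exact_mod_cast (mul_gaussWeight_pos ht.1).ne'
    · rw [uIoc_of_le hs0.le]
      refine (ae_restrict_iff' measurableSet_Ioc).2 (.of_forall fun t ht => ?_)
      have hg := mul_gaussWeight_pos (lam := lam) ht.1
      have hrt : 0 < Real.sqrt t := Real.sqrt_pos.2 ht.1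
      simp only [hr]
      rw [norm_div, Complex.norm_real, Real.norm_of_nonneg hg.le, Real.norm_of_nonneg (by
        have := ht.1; positivity), div_le_iff₀ hg]
      refine (hQb t ht).trans ?_
      rw [Real.rpow_neg ht.1.le, ← Real.sqrt_eq_rpow]
      have e : K * C * (N + 1) * C * (Real.sqrt t)⁻¹ * (t * gaussWeight lam t)
          = K * C * (N + 1) * Real.sqrt t * (C * gaussWeight lam t) := by
        nth_rewrite 2 [← Real.mul_self_sqrt ht.1.le]
        field_simp
      rw [e]
      refine le_mul_of_one_le_right (by positivity) ?_
      have := (hCb t ⟨ht.1.le, ht.2⟩).2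
      rwa [inv_le_iff_one_le_mul₀' hC] at this
  have hRp : ∀ s ∈ J, IsPrimitiveOn R r 0 s := fun s hs =>
    ⟨(hJ0 hs).le, hrI s hs, fun x _ => by simp [hR]⟩
  have hJc : J.OrdConnected := ⟨fun x hx y hy z hz => hJl y hy ⟨(hJ0 hx).trans_le hz.1, hz.2⟩⟩
  have hup : ∀ x ∈ J, ∃ y ∈ J, x < y := by
    intro x hx
    obtain ⟨ε, hε, hεJ⟩ := Metric.isOpen_iff.1 hJ x hx
    refine ⟨x + ε / 2, hεJ ?_, by linarith⟩
    rw [Metric.mem_ball, Real.dist_eq, add_sub_cancel_left, abs_of_pos (by positivity)]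
    linarith
  have hloc : ∀ {k : ℝ → ℂ}, (∀ s ∈ J, IntegrableOn k (Ioc 0 s)) → LocallyIntegrableOn k J := by
    intro k hk x hx
    obtain ⟨y, hy, hxy⟩ := hup x hx
    exact ⟨Ioc 0 y, mem_nhdsWithin_of_mem_nhds (Ioc_mem_nhds (hJ0 hx) hxy), hk y hy⟩
  have hRi : ∀ s ∈ J, IntegrableOn R (Ioc 0 s) := fun s hs =>
    ((hRp s hs).continuousOn.integrableOn_Icc).mono_set Ioc_subset_Icc_self
  have hdiff : LocallyIntegrableOn (fun s => U s - R s) J :=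
    hloc fun s hs => (hUi s hs).sub (hRi s hs)
  obtain ⟨c, hc⟩ := ae_eq_const_of_integral_deriv_smul_eq_zero hJ hJc hdiff (by
    intro ζ hζ hζc hζJ
    rcases J.eq_empty_or_nonempty with hJe | ⟨x₀, hx₀⟩
    · have : ζ = 0 := by
        rw [← tsupport_eq_empty_iff]; exact subset_eq_empty hζJ hJe
      simp [this]
    obtain ⟨M, hMJ, hM⟩ : ∃ M ∈ J, ∀ x ∈ tsupport ζ, x < M := by
      have hcomp : IsCompact (insert x₀ (tsupport ζ)) := hζc.isCompact.insert x₀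
      obtain ⟨M₀, hM₀, hmax⟩ := hcomp.exists_isGreatest (insert_nonempty _ _)
      have : M₀ ∈ J := (insert_subset hx₀ hζJ) hM₀
      obtain ⟨M, hM, hlt⟩ := hup M₀ this
      exact ⟨M, hM, fun x hx => (hmax (Or.inr hx)).trans_lt hlt⟩
    have hM0 : 0 < M := hJ0 hMJ
    have hζ0 : ∀ x, M ≤ x → ζ x = 0 := fun x hx =>
      image_eq_zero_of_notMem_tsupport fun h => (hM x h).not_ge hx
    have hζd0 : ∀ x, M ≤ x → deriv ζ x = 0 := fun x hx =>
      image_eq_zero_of_notMem_tsupport fun h => (hM x (tsupport_deriv_subset h)).not_ge hx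
    -- the test function `η` with `s p η' = ζ` vanishing to the right of the support of `ζ`; near the
    -- origin it is a constant, in general nonzero
    set θ : ℝ → ℝ := fun s => ζ s / (s * gaussWeight lam s) with hθ
    have hθs : ContDiff ℝ ∞ θ := by
      refine contDiff_iff_contDiffAt.2 fun x => ?_
      by_cases hx' : x ∈ tsupport ζ
      swap
      · have h0 : θ =ᶠ[𝓝 x] fun _ => 0 := by
          filter_upwards [notMem_tsupport_iff_eventuallyEq.1 hx'] with y hy
          simp [hθ, hy]
        exact contDiffAt_const.congr_of_eventuallyEq h0
      exact hζ.contDiffAt.div (contDiff_id.mul (contDiff_gaussWeight lam)).contDiffAt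
        (mul_gaussWeight_pos (hJ0 (hζJ hx'))).ne'
    obtain ⟨hηs, hηd⟩ := contDiff_primitive_and_deriv hθs M
    set η : ℝ → ℝ := fun x => ∫ t in M..x, θ t with hη
    have hη0 : ∀ s, M ≤ s → η s = 0 := by
      intro s hs
      simp only [hη]
      rw [intervalIntegral.integral_congr (g := fun _ => 0), intervalIntegral.integral_zero]
      intro t ht
      rw [uIcc_of_le hs] at ht
      simp [hθ, hζ0 t ht.1]
    have hflux : (fun s => s * gaussWeight lam s * deriv η s) = ζ := by
      ext s
      rw [hηd]
      by_cases hs : s = 0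
      · have : ζ 0 = 0 := image_eq_zero_of_notMem_tsupport fun h => lt_irrefl (0 : ℝ) (hJ0 (hζJ h))
        simp [hs, this]
      · have := (gaussWeight_pos lam s).ne'
        simp only [hθ]; field_simp
    have hw := hweak η hηs ⟨M, hMJ, hη0⟩
    rw [hflux] at hw
    have hζdc : Continuous (deriv ζ) := hζ.continuous_deriv (by norm_num)
    -- everything lives on `(0, M]`
    have hw1 : (∫ s in 0..M, f s * ((η s : ℝ) : ℂ)) = ∫ s in 0..M, U s * ((deriv ζ s : ℝ) : ℂ) := by
      have i1 : IntegrableOn (fun s => f s * ((η s : ℝ) : ℂ)) (Ioc 0 M) :=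
        ((hfI M hMJ).mul_continuousOn
          (Complex.continuous_ofReal.comp hηs.continuous).continuousOn).1
      have i2 : IntegrableOn (fun s => U s * ((deriv ζ s : ℝ) : ℂ)) (Ioc 0 M) :=
        (((intervalIntegrable_iff_integrableOn_Ioc_of_le hM0.le).2 (hUi M hMJ)).mul_continuousOn
          (Complex.continuous_ofReal.comp hζdc).continuousOn).1
      rw [intervalIntegral.integral_of_le hM0.le, intervalIntegral.integral_of_le hM0.le,
        ← sub_eq_zero, ← integral_sub i1 i2, ← hw]
      rw [setIntegral_eq_of_subset_of_forall_sdiff_eq_zero measurableSet_Ioi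
        (Ioc_subset_Ioi_self : Ioc 0 M ⊆ Ioi 0)]
      · refine setIntegral_congr_fun measurableSet_Ioc fun s _ => ?_
        simp only [hf]
        push_cast
        ring
      · intro s hs
        have : M < s := by
          by_contra h'
          exact hs.2 ⟨hs.1, not_lt.1 h'⟩
        simp [hζd0 s this.le, hη0 s this.le]
    have hηp : IsPrimitiveOn (fun s => ((η s : ℝ) : ℂ)) (fun s => ((θ s : ℝ) : ℂ)) 0 M := by
      refine .of_hasDerivAt hM0.le (fun x => ?_) (Complex.continuous_ofReal.comp hθs.continuous)
      have := (hηs.differentiable (by norm_num) x).hasDerivAt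
      rw [hηd] at this
      exact this.ofReal_comp
    have hζp : IsPrimitiveOn (fun s => ((ζ s : ℝ) : ℂ)) (fun s => ((deriv ζ s : ℝ) : ℂ)) 0 M := by
      refine .of_hasDerivAt hM0.le (fun x => ?_) (Complex.continuous_ofReal.comp hζdc)
      exact (hζ.differentiable (by norm_num) x).hasDerivAt.ofReal_comp
    have e1 := ((hQp M hMJ).mul hηp)
    have e2 := ((hRp M hMJ).mul hζp)
    have e1s := e1.sub_eq
    have e2s := e2.sub_eq
    have hQ0 : Q 0 = 0 := by simp [hQ]
    have hR0 : R 0 = 0 := by simp [hR]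
    simp only [hη0 M le_rfl, hζ0 M le_rfl, hQ0, hR0, Complex.ofReal_zero, zero_mul, mul_zero,
      sub_zero] at e1s e2s
    have j1 : IntervalIntegrable (fun s => f s * ((η s : ℝ) : ℂ)) volume 0 M :=
      (hfI M hMJ).mul_continuousOn (Complex.continuous_ofReal.comp hηs.continuous).continuousOn
    have j2 : IntervalIntegrable (fun s => R s * ((deriv ζ s : ℝ) : ℂ)) volume 0 M := by
      refine ContinuousOn.intervalIntegrable ?_
      rw [uIcc_of_le hM0.le]
      exact (hRp M hMJ).continuousOn.mul (Complex.continuous_ofReal.comp hζdc).continuousOn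
    have j3 : IntervalIntegrable (fun s => U s * ((deriv ζ s : ℝ) : ℂ)) volume 0 M :=
      ((intervalIntegrable_iff_integrableOn_Ioc_of_le hM0.le).2 (hUi M hMJ)).mul_continuousOn
          (Complex.continuous_ofReal.comp hζdc).continuousOn
    have key : ∫ s in 0..M, (U s * ((deriv ζ s : ℝ) : ℂ) - R s * ((deriv ζ s : ℝ) : ℂ)) = 0 := by
      rw [intervalIntegral.integral_sub j3 j2, ← hw1, ← intervalIntegral.integral_sub j1 j2]
      have : ∫ s in 0..M, (f s * ((η s : ℝ) : ℂ) - R s * ((deriv ζ s : ℝ) : ℂ))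
          = ∫ s in 0..M, ((f s * ((η s : ℝ) : ℂ) + Q s * ((θ s : ℝ) : ℂ))
            - (r s * ((ζ s : ℝ) : ℂ) + R s * ((deriv ζ s : ℝ) : ℂ))) := by
        congr 1; ext s
        simp only [hr, hθ]
        push_cast
        ring
      rw [this, intervalIntegral.integral_sub e1.integrable e2.integrable, ← e1s, ← e2s, sub_zero]
    rw [intervalIntegral.integral_of_le hM0.le] at key
    rw [← key, ← setIntegral_eq_integral_of_forall_compl_eq_zero (s := Ioc 0 M)]
    · refine setIntegral_congr_fun measurableSet_Ioc fun s _ => ?_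
      simp only [Complex.real_smul]
      ring
    · intro s hs
      have : deriv ζ s = 0 := by
        refine image_eq_zero_of_notMem_tsupport fun h => hs ?_
        have h' := tsupport_deriv_subset h
        exact ⟨hJ0 (hζJ h'), (hM s h').le⟩
      simp [this])
  refine ⟨fun s => c + R s, Q, ?_, fun S hS => ⟨by simp [hQ], ?_, ?_⟩⟩
  · filter_upwards [hc] with s hs hsJ
    rw [← hs hsJ]; ring
  · have hae : ∀ᵐ t, t ∈ uIoc 0 S → f t = ((V t * gaussWeight lam t : ℝ) : ℂ) * (c + R t) := by
      filter_upwards [hc] with t ht htS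
      rw [uIoc_of_le (hJ0 hS).le] at htS
      simp only [hf]
      rw [← ht (hJl S hS htS)]; ring
    refine ⟨(hJ0 hS).le, ?_, fun x hx => ?_⟩
    · exact (hfI S hS).congr_ae ((ae_restrict_iff' measurableSet_uIoc).2 hae)
    · rw [(hQp S hS).eq x hx]
      congr 1
      refine intervalIntegral.integral_congr_ae ?_
      filter_upwards [hae] with t ht htx
      refine ht ?_
      rw [uIoc_of_le hx.1] at htx
      rw [uIoc_of_le (hJ0 hS).le]
      exact ⟨htx.1, htx.2.trans hx.2⟩
  · refine ⟨(hJ0 hS).le, hrI S hS, fun x hx => ?_⟩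
    simp [hR, hr]

/-! ### Polar coordinates and circular means -/

/-- Polar coordinates with the squared radius `s = |x|²` as radial variable, so that the Jacobian is
the constant `1 / 2`. -/
noncomputable def polarMap (z : ℝ × ℝ) : Plane :=
  !₂[Real.sqrt z.1 * Real.cos z.2, Real.sqrt z.1 * Real.sin z.2]

theorem continuous_polarMap : Continuous polarMap := by
  unfold polarMap
  refine (PiLp.continuous_toLp 2 _).comp (continuous_pi fun i => ?_)
  fin_cases i <;> simp <;> fun_prop

theorem normSq_eq (x : Plane) : ‖x‖ ^ 2 = x 0 ^ 2 + x 1 ^ 2 := by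
  rw [EuclideanSpace.norm_sq_eq]; simp

theorem normSq_polarMap {s : ℝ} (hs : 0 ≤ s) (θ : ℝ) : ‖polarMap (s, θ)‖ ^ 2 = s := by
  rw [normSq_eq]
  simp only [polarMap, PiLp.toLp_apply, Matrix.cons_val_zero, Matrix.cons_val_one]
  rw [mul_pow, mul_pow, Real.sq_sqrt hs]
  linear_combination s * Real.cos_sq_add_sin_sq θ

theorem norm_polarMap {s : ℝ} (hs : 0 ≤ s) (θ : ℝ) : ‖polarMap (s, θ)‖ = Real.sqrt s := by
  rw [← Real.sqrt_sq (norm_nonneg (polarMap (s, θ))), normSq_polarMap hs]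

/-- The measure `ds dθ` on `(0, ∞) × (-π, π]`. -/
noncomputable def polarMeasure : Measure (ℝ × ℝ) :=
  (volume.restrict (Ioi (0 : ℝ))).prod (volume.restrict (Ioc (-Real.pi) Real.pi))

/-- The substitution `s = r²`. -/
theorem lintegral_Ioi_eq_sq (f : ℝ → ENNReal) :
    ∫⁻ s in Ioi (0 : ℝ), f s = ∫⁻ r in Ioi (0 : ℝ), ENNReal.ofReal (2 * r) * f (r ^ 2) := by
  have him : (fun r : ℝ => r ^ 2) '' Ioi 0 = Ioi 0 := by
    ext s; constructor
    · rintro ⟨r, hr, rfl⟩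
      exact pow_pos (mem_Ioi.1 hr) 2
    · intro hs
      exact ⟨Real.sqrt s, Real.sqrt_pos.2 hs, Real.sq_sqrt (mem_Ioi.1 hs).le⟩
  have := lintegral_image_eq_lintegral_abs_deriv_mul (f := fun r : ℝ => r ^ 2)
    (f' := fun r => 2 * r) measurableSet_Ioi
    (fun x _ => by simpa using ((hasDerivAt_pow 2 x).hasDerivWithinAt (s := Ioi 0)))
    (fun x hx y hy hxy => by
      have h1 := mem_Ioi.1 hx
      have h2 := mem_Ioi.1 hy
      exact (pow_left_inj₀ h1.le h2.le two_ne_zero).1 hxy) f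
  rw [him] at this
  rw [this]
  refine setLIntegral_congr_fun measurableSet_Ioi fun r hr => ?_
  have h1 := mem_Ioi.1 hr
  rw [abs_of_pos (by linarith)]

theorem lintegral_polarMap {f : Plane → ENNReal} (hf : Measurable f) :
    ∫⁻ z, f (polarMap z) ∂polarMeasure = 2 * ∫⁻ x, f x := by
  have e1 : ∫⁻ x, f x = ∫⁻ p : ℝ × ℝ, f !₂[p.1, p.2] := by
    have h1 := (EuclideanSpace.volume_preserving_symm_measurableEquiv_toLp (Fin 2)).symm
    have h2 := (volume_preserving_finTwoArrow ℝ).symm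
    have h3 := h1.comp h2
    rw [← h3.lintegral_comp hf]
    rfl
  rw [e1, ← lintegral_comp_polarCoord_symm, ← lintegral_const_mul' _ _ (by simp), polarCoord_target]
  have hm : Measurable fun z : ℝ × ℝ => f (polarMap z) :=
    hf.comp continuous_polarMap.measurable
  have hμ : (volume.restrict (Ioi (0 : ℝ) ×ˢ Ioo (-Real.pi) Real.pi) : Measure (ℝ × ℝ))
      = polarMeasure := by
    rw [polarMeasure, Measure.volume_eq_prod, ← Measure.prod_restrict,
      Measure.restrict_congr_set Ioo_ae_eq_Ioc]
  rw [hμ, polarMeasure, lintegral_prod_symm' _ hm]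
  have hm2 : Measurable fun z : ℝ × ℝ => 2 * (ENNReal.ofReal z.1 • f !₂[(polarCoord.symm z).1,
      (polarCoord.symm z).2]) := by
    refine Measurable.const_mul (Measurable.smul
      (ENNReal.measurable_ofReal.comp measurable_fst) (hf.comp ?_)) _
    refine Continuous.measurable ?_
    refine (PiLp.continuous_toLp 2 _).comp (continuous_pi fun i => ?_)
    fin_cases i <;> simp [polarCoord] <;> fun_prop
  rw [lintegral_prod_symm' _ hm2]
  refine lintegral_congr fun θ => ?_
  rw [lintegral_Ioi_eq_sq]
  refine setLIntegral_congr_fun measurableSet_Ioi fun r hr => ?_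
  have h1 := mem_Ioi.1 hr
  simp only [polarMap, polarCoord_symm_apply, smul_eq_mul]
  rw [Real.sqrt_sq h1.le, ENNReal.ofReal_mul (by norm_num), mul_assoc, ENNReal.ofReal_ofNat]

theorem measurePreserving_polarMap :
    MeasurePreserving polarMap polarMeasure ((2 : ENNReal) • volume) := by
  refine ⟨continuous_polarMap.measurable, ?_⟩
  refine Measure.ext_of_lintegral _ fun f hf => ?_
  rw [lintegral_map hf continuous_polarMap.measurable, lintegral_polarMap hf,
    lintegral_smul_measure, smul_eq_mul]

theorem quasiMeasurePreserving_polarMap :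
    Measure.QuasiMeasurePreserving polarMap polarMeasure volume :=
  ⟨continuous_polarMap.measurable, by
    rw [measurePreserving_polarMap.map_eq]
    exact Measure.smul_absolutelyContinuous⟩

theorem ae_polarMap {P : Plane → Prop} (h : ∀ᵐ x, P x) :
    ∀ᵐ s ∂volume.restrict (Ioi (0 : ℝ)), ∀ᵐ θ ∂volume.restrict (Ioc (-Real.pi) Real.pi),
      P (polarMap (s, θ)) :=
  Measure.ae_ae_of_ae_prod (quasiMeasurePreserving_polarMap.ae h)

/-- A property of almost every `s > 0` holds at `s = |x|²` for almost every point `x`. -/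
theorem ae_normSq {P : ℝ → Prop} (h : ∀ᵐ s ∂volume.restrict (Ioi (0 : ℝ)), P s) :
    ∀ᵐ x : Plane, P (‖x‖ ^ 2) := by
  have hq : Measure.QuasiMeasurePreserving (fun x : Plane => ‖x‖ ^ 2) volume
      (volume.restrict (Ioi (0 : ℝ))) := by
    refine ⟨by fun_prop, Measure.AbsolutelyContinuous.mk fun N hN hN0 => ?_⟩
    have hm : Measurable fun x : Plane => ‖x‖ ^ 2 := by fun_prop
    rw [Measure.map_apply hm hN]
    have h2 : (2 : ENNReal) * volume ((fun x : Plane => ‖x‖ ^ 2) ⁻¹' N) = 0 := by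
      have := measurePreserving_polarMap.measure_preimage (hm hN).nullMeasurableSet
      rw [Measure.smul_apply, smul_eq_mul] at this
      rw [← this]
      have hpre : ∀ᵐ z ∂polarMeasure, z.1 ∉ N := by
        have : ∀ᵐ s ∂volume.restrict (Ioi (0 : ℝ)), s ∉ N := measure_eq_zero_iff_ae_notMem.1 hN0
        exact Measure.quasiMeasurePreserving_fst.ae this
      have hpos : ∀ᵐ z ∂polarMeasure, z.1 ∈ Ioi (0 : ℝ) :=
        Measure.quasiMeasurePreserving_fst.ae (ae_restrict_mem measurableSet_Ioi)
      rw [measure_eq_zero_iff_ae_notMem]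
      filter_upwards [hpre, hpos] with z h1 h2 h3
      simp only [mem_preimage] at h3
      rw [normSq_polarMap (mem_Ioi.1 h2).le] at h3
      exact h1 h3
    simpa using h2
  exact hq.ae h

/-- The mean of `ψ` over the circle of squared radius `s`. -/
noncomputable def circleMean (ψ : Plane → ℂ) (s : ℝ) : ℂ :=
  (2 * Real.pi : ℂ)⁻¹ * ∫ θ in (-Real.pi)..Real.pi, ψ (polarMap (s, θ))

theorem circleMean_eq (ψ : Plane → ℂ) (s : ℝ) : circleMean ψ s
    = (2 * Real.pi : ℂ)⁻¹ * ∫ θ in Ioc (-Real.pi) Real.pi, ψ (polarMap (s, θ)) := by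
  rw [circleMean, intervalIntegral.integral_of_le (by linarith [Real.pi_pos])]

theorem circleMean_eq_of_ae {ψ : Plane → ℂ} {s : ℝ} {c : ℂ}
    (h : ∀ᵐ θ ∂volume.restrict (Ioc (-Real.pi) Real.pi), ψ (polarMap (s, θ)) = c) :
    circleMean ψ s = c := by
  rw [circleMean_eq, integral_congr_ae h, setIntegral_const]
  have := Real.pi_pos
  rw [Real.volume_real_Ioc_of_le (by linarith), Complex.real_smul]
  have h2 : (Real.pi : ℂ) ≠ 0 := by exact_mod_cast this.ne'
  push_cast
  field_simp
  ring

theorem circleMean_zero (ψ : Plane → ℂ) : circleMean ψ 0 = ψ 0 := by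
  refine circleMean_eq_of_ae (.of_forall fun θ => ?_)
  congr 1
  ext i
  fin_cases i <;> simp [polarMap]

theorem continuous_circleMean {ψ : Plane → ℂ} (hψ : Continuous ψ) :
    Continuous (circleMean ψ) := by
  unfold circleMean
  refine continuous_const.mul ?_
  exact intervalIntegral.continuous_parametric_intervalIntegral_of_continuous'
    (f := fun s θ => ψ (polarMap (s, θ))) (hψ.comp continuous_polarMap) _ _

/-- Only the circular means of `ψ` enter its pairing with a radial function. -/
theorem integral_mul_radial {ψ : Plane → ℂ} {H : ℝ → ℂ}
    (hi : Integrable fun x => ψ x * H (‖x‖ ^ 2)) :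
    ∫ x, ψ x * H (‖x‖ ^ 2) = Real.pi * ∫ s in Ioi 0, circleMean ψ s * H s := by
  have hi2 : Integrable (fun x => ψ x * H (‖x‖ ^ 2)) ((2 : ENNReal) • volume : Measure Plane) :=
    hi.smul_measure (by simp)
  have h1 : ∫ z, ψ (polarMap z) * H (‖polarMap z‖ ^ 2) ∂polarMeasure
      = 2 * ∫ x, ψ x * H (‖x‖ ^ 2) := by
    have := integral_map (φ := polarMap) (μ := polarMeasure)
      continuous_polarMap.measurable.aemeasurable
      (f := fun x => ψ x * H (‖x‖ ^ 2))
      (by rw [measurePreserving_polarMap.map_eq]; exact hi2.aestronglyMeasurable)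
    rw [← this, measurePreserving_polarMap.map_eq, integral_smul_measure]
    simp
  have hi3 : Integrable (fun z => ψ (polarMap z) * H (‖polarMap z‖ ^ 2)) polarMeasure := by
    have := (measurePreserving_polarMap.integrable_comp hi2.aestronglyMeasurable).2 hi2
    exact this
  have h2 : ∫ z, ψ (polarMap z) * H (‖polarMap z‖ ^ 2) ∂polarMeasure
      = 2 * Real.pi * ∫ s in Ioi 0, circleMean ψ s * H s := by
    rw [polarMeasure, integral_prod _ hi3, ← integral_const_mul]
    refine setIntegral_congr_fun measurableSet_Ioi fun s hs => ?_
    have hs0 := (mem_Ioi.1 hs).le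
    simp only [normSq_polarMap hs0]
    rw [integral_mul_const, circleMean_eq]
    have h2 : (Real.pi : ℂ) ≠ 0 := by exact_mod_cast Real.pi_pos.ne'
    field_simp
  have h3 : (2 : ℂ) * ∫ x, ψ x * H (‖x‖ ^ 2)
      = 2 * (Real.pi * ∫ s in Ioi 0, circleMean ψ s * H s) := by
    rw [← h1, h2]; ring
  exact mul_left_cancel₀ two_ne_zero h3

/-- A radial function agrees almost everywhere with its circular means; unlike the function of `|x|`
provided by `IsRadial`, these are measurable. -/
theorem IsRadial.ae_eq_circleMean {φ : Plane → ℂ} (h : IsRadial φ) :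
    ∀ᵐ x : Plane, φ x = circleMean φ (‖x‖ ^ 2) := by
  obtain ⟨f, hf⟩ := h
  have h1 : ∀ᵐ s ∂volume.restrict (Ioi (0 : ℝ)), circleMean φ s = f (Real.sqrt s) := by
    filter_upwards [ae_polarMap hf, ae_restrict_mem measurableSet_Ioi] with s hs hs0
    refine circleMean_eq_of_ae ?_
    filter_upwards [hs] with θ hθ
    rw [hθ, norm_polarMap (mem_Ioi.1 hs0).le]
  filter_upwards [hf, ae_normSq h1] with x hx hx'
  rw [hx', hx, Real.sqrt_sq (norm_nonneg _)]

theorem aestronglyMeasurable_circleMean {ψ : Plane → ℂ} (hψ : AEStronglyMeasurable ψ volume) :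
    AEStronglyMeasurable (circleMean ψ) (volume.restrict (Ioi (0 : ℝ))) := by
  have h1 : AEStronglyMeasurable (fun z => ψ (polarMap z)) polarMeasure :=
    hψ.comp_quasiMeasurePreserving quasiMeasurePreserving_polarMap
  have h2 := (AEStronglyMeasurable.integral_prod_right' (h1 : AEStronglyMeasurable _
    ((volume.restrict (Ioi (0 : ℝ))).prod (volume.restrict (Ioc (-Real.pi) Real.pi)))))
  refine (h2.const_mul (2 * Real.pi : ℂ)⁻¹).congr (.of_forall fun s => ?_)
  rw [circleMean_eq]

theorem IsRadial.integrableOn_circleMean_sq {φ : Plane → ℂ} (h : IsRadial φ)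
    (hφ : MemLp φ 2 volume) : IntegrableOn (fun s => ‖circleMean φ s‖ ^ 2) (Ioi 0) := by
  have h1 : Integrable (fun x => ‖φ x‖ ^ 2) ((2 : ENNReal) • volume : Measure Plane) :=
    ((memLp_two_iff_integrable_sq_norm hφ.1).1 hφ).smul_measure (by simp)
  have h2 : Integrable (fun z => ‖φ (polarMap z)‖ ^ 2) polarMeasure :=
    (measurePreserving_polarMap.integrable_comp h1.aestronglyMeasurable).2 h1
  have h3 : Integrable (fun s => ∫ θ in Ioc (-Real.pi) Real.pi, ‖φ (polarMap (s, θ))‖ ^ 2)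
      (volume.restrict (Ioi 0)) := Integrable.integral_prod_left h2
  have h4 : Integrable (fun s => 2 * Real.pi * ‖circleMean φ s‖ ^ 2) (volume.restrict (Ioi 0)) := by
    refine h3.congr ?_
    filter_upwards [ae_polarMap h.ae_eq_circleMean, ae_restrict_mem measurableSet_Ioi] with s hs hs0
    have : ∀ᵐ θ ∂volume.restrict (Ioc (-Real.pi) Real.pi),
        ‖φ (polarMap (s, θ))‖ ^ 2 = ‖circleMean φ s‖ ^ 2 := by
      filter_upwards [hs] with θ hθ
      rw [hθ, normSq_polarMap (mem_Ioi.1 hs0).le]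
    rw [integral_congr_ae this, setIntegral_const, Real.volume_real_Ioc_of_le
      (by linarith [Real.pi_pos]), smul_eq_mul]
    ring
  have := h4.const_mul (2 * Real.pi)⁻¹
  refine this.congr (.of_forall fun s => ?_)
  have := Real.pi_pos.ne'
  simp only
  field_simp

/-! ### Magnetic momenta of translated and radial test functions -/

theorem vecPot_zero_apply (x : Plane) : vecPot x 0 = -(x 1) / 2 := by simp [vecPot]

theorem vecPot_one_apply (x : Plane) : vecPot x 1 = x 0 / 2 := by simp [vecPot]

theorem inner_vecPot (x y : Plane) : inner ℝ x (vecPot y) = (x 1 * y 0 - x 0 * y 1) / 2 := by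
  rw [PiLp.inner_apply, Fin.sum_univ_two, vecPot_zero_apply, vecPot_one_apply]
  simp
  ring

theorem vecPot_sum_sq (x : Plane) : vecPot x 0 ^ 2 + vecPot x 1 ^ 2 = ‖x‖ ^ 2 / 4 := by
  rw [vecPot_zero_apply, vecPot_one_apply, normSq_eq]; ring

theorem contDiff_coord (j : Fin 2) : ContDiff ℝ ∞ (fun y : Plane => y j) :=
  (EuclideanSpace.proj j : Plane →L[ℝ] ℝ).contDiff

theorem contDiff_vecPot (j : Fin 2) : ContDiff ℝ ∞ (fun y : Plane => vecPot y j) := by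
  fin_cases j
  · simp only [Fin.zero_eta, vecPot_zero_apply]
    exact (contDiff_coord 1).neg.div_const 2
  · simp only [Fin.mk_one, vecPot_one_apply]
    exact (contDiff_coord 0).div_const 2

theorem contDiff_ofReal : ContDiff ℝ ∞ (fun x : ℝ => (x : ℂ)) := Complex.ofRealCLM.contDiff

/-- Each component of the vector potential is independent of the corresponding coordinate. -/
theorem vecPot_line (x : Plane) (j : Fin 2) (t : ℝ) :
    vecPot (x + t • unitVec j) j = vecPot x j := by
  fin_cases j
  · simp [vecPot_zero_apply, unitVec]
  · simp [vecPot_one_apply, unitVec]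

theorem coord_line (x : Plane) (j : Fin 2) (t : ℝ) :
    (x + t • unitVec j) j = x j + t := by
  simp [unitVec]

theorem normSq_line (x : Plane) (j : Fin 2) (t : ℝ) :
    ‖x + t • unitVec j‖ ^ 2 = ‖x‖ ^ 2 + 2 * t * x j + t ^ 2 := by
  rw [normSq_eq, normSq_eq]
  fin_cases j <;> simp [unitVec] <;> ring

/-- Directional derivatives of differentiable functions are computed along lines. -/
theorem fderiv_eq_of_line {χ : Plane → ℂ} {x : Plane} {v : Plane} {c : ℂ}
    (hχ : DifferentiableAt ℝ χ x) (h : HasDerivAt (fun t : ℝ => χ (x + t • v)) c 0) :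
    fderiv ℝ χ x v = c := by
  rw [← hχ.lineDeriv_eq_fderiv]
  exact HasLineDerivAt.lineDeriv h

theorem IsTest.transposeMomentum {χ : Plane → ℂ} (h : IsTest χ) (b : ℝ) (j : Fin 2) :
    IsTest (transposeMomentum b j χ) := by
  have hd : ContDiff ℝ ∞ fun x => fderiv ℝ χ x (unitVec j) :=
    (h.1.fderiv_right (m := ∞) (by norm_num)).clm_apply contDiff_const
  refine ⟨?_, ?_⟩
  · unfold MagneticWell.transposeMomentum
    exact (contDiff_const.mul hd).sub
      ((contDiff_ofReal.comp (contDiff_const.mul (contDiff_vecPot j))).mul h.1)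
  · refine HasCompactSupport.of_support_subset_isCompact h.2 fun x hx => ?_
    by_contra hc
    refine hx ?_
    have h1 : χ x = 0 := image_eq_zero_of_notMem_tsupport hc
    have h2 : fderiv ℝ χ x = 0 := image_eq_zero_of_notMem_tsupport fun h' =>
      hc (tsupport_fderiv_subset ℝ h')
    simp [MagneticWell.transposeMomentum, h1, h2]

/-- The eigenvalue equation with both derivatives moved to the test function. -/
theorem HamiltonianEq.weak_eq {b lam e : ℝ} {v : Plane → ℝ} {φ : Plane → ℂ}
    (h : HamiltonianEq b lam v φ fun x => (e : ℂ) * φ x) {χ : Plane → ℂ} (hχ : IsTest χ) :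
    (∑ j, ∫ x, φ x * transposeMomentum b j (transposeMomentum b j χ) x)
      + ∫ x, ((lam ^ 2 * v x : ℝ) : ℂ) * φ x * χ x = ∫ x, (e : ℂ) * φ x * χ x := by
  obtain ⟨-, g, hg, hw⟩ := h
  rw [← hw χ hχ]
  congr 1
  exact Finset.sum_congr rfl fun j _ => (hg.weak j _ (hχ.transposeMomentum b j)).symm

/-- The inverse magnetic translation of a test function. -/
noncomputable def translateTest (b : ℝ) (d : Plane) (χ : Plane → ℂ) (y : Plane) : ℂ :=
  Complex.exp (Complex.I * ((b * inner ℝ y (vecPot d) : ℝ) : ℂ)) * χ (y + d)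

theorem contDiff_magneticPhase (b : ℝ) (d : Plane) : ContDiff ℝ ∞
    fun y : Plane => Complex.exp (Complex.I * ((b * inner ℝ y (vecPot d) : ℝ) : ℂ)) :=
  (contDiff_const.mul (contDiff_ofReal.comp
    (contDiff_const.mul (contDiff_id.inner ℝ contDiff_const)))).cexp

theorem IsTest.translateTest {χ : Plane → ℂ} (h : IsTest χ) (b : ℝ) (d : Plane) :
    IsTest (translateTest b d χ) := by
  refine ⟨(contDiff_magneticPhase b d).mul (h.1.comp (contDiff_id.add contDiff_const)), ?_⟩
  refine HasCompactSupport.mul_left ?_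
  exact h.2.comp_homeomorph (Homeomorph.addRight d)

/-- Magnetic translations commute with the magnetic momenta. -/
theorem transposeMomentum_translateTest {χ : Plane → ℂ} (hχ : Differentiable ℝ χ) (b : ℝ)
    (d : Plane) (j : Fin 2) :
    transposeMomentum b j (translateTest b d χ)
      = translateTest b d (transposeMomentum b j χ) := by
  ext y
  have hdiff : DifferentiableAt ℝ (translateTest b d χ) y := by
    have h1 := (contDiff_magneticPhase b d).differentiable (by norm_num)
    exact (h1 y).mul ((hχ.comp (differentiable_id.add (differentiable_const d))) y)
  have hline : HasDerivAt (fun t : ℝ => translateTest b d χ (y + t • unitVec j))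
      (Complex.exp (Complex.I * ((b * inner ℝ y (vecPot d) : ℝ) : ℂ))
          * (Complex.I * ((b * vecPot d j : ℝ) : ℂ)) * χ (y + d)
        + Complex.exp (Complex.I * ((b * inner ℝ y (vecPot d) : ℝ) : ℂ))
          * fderiv ℝ χ (y + d) (unitVec j)) 0 := by
    have h1 : HasDerivAt (fun t : ℝ => χ ((y + t • unitVec j) + d))
        (fderiv ℝ χ (y + d) (unitVec j)) 0 := by
      have := ((hχ (y + d)).hasFDerivAt.hasLineDerivAt (unitVec j))
      refine HasDerivAt.congr_of_eventuallyEq this (.of_forall fun t => ?_)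
      simp only; congr 1; abel
    have h2 : HasDerivAt (fun t : ℝ => Complex.I
        * ((b * inner ℝ (y + t • unitVec j) (vecPot d) : ℝ) : ℂ))
        (Complex.I * ((b * vecPot d j : ℝ) : ℂ)) 0 := by
      refine HasDerivAt.const_mul _ (HasDerivAt.ofReal_comp ?_)
      have h3 : ∀ t : ℝ, b * inner ℝ (y + t • unitVec j) (vecPot d)
          = b * inner ℝ y (vecPot d) + t * (b * vecPot d j) := by
        intro t
        rw [inner_add_left, inner_smul_left]
        have : inner ℝ (unitVec j) (vecPot d) = vecPot d j := by
          rw [unitVec, EuclideanSpace.inner_single_left]; simp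
        rw [this]; simp; ring
      simp only [h3]
      simpa using ((hasDerivAt_id (0 : ℝ)).mul_const (b * vecPot d j)).const_add
        (b * inner ℝ y (vecPot d))
    have h4 := h2.cexp.mul h1
    refine (h4.congr_of_eventuallyEq (.of_forall fun t => ?_)).congr_deriv ?_
    · simp [translateTest]
    · simp
  rw [transposeMomentum, fderiv_eq_of_line hdiff hline]
  simp only [translateTest, transposeMomentum]
  have : vecPot (y + d) j = vecPot y j + vecPot d j := by
    fin_cases j
    · simp only [Fin.zero_eta, vecPot_zero_apply, PiLp.add_apply]; ring
    · simp only [Fin.mk_one, vecPot_one_apply, PiLp.add_apply]; ring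
  rw [this]
  push_cast
  linear_combination (b * vecPot d j * Complex.exp (Complex.I * (b * inner ℝ y (vecPot d)))
    * χ (y + d) : ℂ) * Complex.I_mul_I

theorem hasDerivAt_normSq_line {F : ℝ → ℂ} (hF : Differentiable ℝ F) (x : Plane) (j : Fin 2) :
    HasDerivAt (fun t : ℝ => F (‖x + t • unitVec j‖ ^ 2)) (2 * x j * deriv F (‖x‖ ^ 2)) 0 := by
  have h1 : HasDerivAt (fun t : ℝ => ‖x + t • unitVec j‖ ^ 2) (2 * x j) 0 := by
    simp only [normSq_line]
    have := ((((hasDerivAt_id (0 : ℝ)).const_mul 2).mul_const (x j)).const_add (‖x‖ ^ 2)).add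
      (hasDerivAt_pow 2 (0 : ℝ))
    exact this.congr_deriv (by simp)
  have h2 : HasDerivAt F (deriv F (‖x‖ ^ 2)) (‖x + (0 : ℝ) • unitVec j‖ ^ 2) := by
    simpa using (hF (‖x‖ ^ 2)).hasDerivAt
  exact (h2.scomp (0 : ℝ) h1).congr_deriv (by simp)

theorem transposeMomentum_radial {F : ℝ → ℂ} (hF : ContDiff ℝ ∞ F) (b : ℝ) (j : Fin 2) :
    transposeMomentum b j (fun x => F (‖x‖ ^ 2)) = fun x =>
      2 * Complex.I * x j * deriv F (‖x‖ ^ 2) - ((b * vecPot x j : ℝ) : ℂ) * F (‖x‖ ^ 2) := by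
  ext x
  have hd : DifferentiableAt ℝ (fun x : Plane => F (‖x‖ ^ 2)) x :=
    ((hF.comp (contDiff_norm_sq ℝ)).differentiable (by norm_num)) x
  rw [transposeMomentum, fderiv_eq_of_line hd
    (hasDerivAt_normSq_line (hF.differentiable (by norm_num)) x j)]
  ring

/-- On radial functions the angular momentum vanishes, and the squared magnetic momentum is the
two-dimensional harmonic oscillator, here in the variable `s = |x|²`. -/
theorem sum_transposeMomentum_sq_radial {F : ℝ → ℂ} (hF : ContDiff ℝ ∞ F) (b : ℝ) (x : Plane) :
    ∑ j, transposeMomentum b j (transposeMomentum b j (fun x => F (‖x‖ ^ 2))) x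
      = -4 * deriv F (‖x‖ ^ 2) - 4 * ((‖x‖ ^ 2 : ℝ) : ℂ) * deriv (deriv F) (‖x‖ ^ 2)
        + ((b ^ 2 * ‖x‖ ^ 2 / 4 : ℝ) : ℂ) * F (‖x‖ ^ 2) := by
  have hF' : ContDiff ℝ ∞ (deriv F) := (contDiff_infty_iff_deriv.1 hF).2
  have key : ∀ j, transposeMomentum b j (transposeMomentum b j (fun x => F (‖x‖ ^ 2))) x
      = Complex.I * (2 * Complex.I * (deriv F (‖x‖ ^ 2)
          + x j * (2 * x j * deriv (deriv F) (‖x‖ ^ 2)))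
          - ((b * vecPot x j : ℝ) : ℂ) * (2 * x j * deriv F (‖x‖ ^ 2)))
        - ((b * vecPot x j : ℝ) : ℂ) * (2 * Complex.I * x j * deriv F (‖x‖ ^ 2)
          - ((b * vecPot x j : ℝ) : ℂ) * F (‖x‖ ^ 2)) := by
    intro j
    rw [transposeMomentum_radial hF]
    have hd : ContDiff ℝ ∞ (fun x : Plane => 2 * Complex.I * x j * deriv F (‖x‖ ^ 2)
        - ((b * vecPot x j : ℝ) : ℂ) * F (‖x‖ ^ 2)) :=
      ((contDiff_const.mul (contDiff_ofReal.comp (contDiff_coord j))).mul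
        (hF'.comp (contDiff_norm_sq ℝ))).sub
        ((contDiff_ofReal.comp (contDiff_const.mul (contDiff_vecPot j))).mul
        (hF.comp (contDiff_norm_sq ℝ)))
    rw [transposeMomentum]
    congr 2
    refine fderiv_eq_of_line ((hd.differentiable (by norm_num)) x) ?_
    simp only [vecPot_line, coord_line]
    have h0 : HasDerivAt (fun t : ℝ => ((x j + t : ℝ) : ℂ)) 1 0 := by
      have := ((hasDerivAt_id (0 : ℝ)).const_add (x j)).ofReal_comp
      simpa using this
    have h1 := (h0.mul (hasDerivAt_normSq_line (hF'.differentiable (by norm_num)) x j)).const_mul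
      (2 * Complex.I)
    have h2 := (hasDerivAt_normSq_line (hF.differentiable (by norm_num)) x j).const_mul
      ((b * vecPot x j : ℝ) : ℂ)
    have h3 := h1.sub h2
    refine (h3.congr_of_eventuallyEq (.of_forall fun t => ?_)).congr_deriv ?_
    · simp only [Pi.sub_apply, Pi.mul_apply]; ring
    · simp
  simp only [key, Fin.sum_univ_two]
  have e1 : (((b ^ 2 * ‖x‖ ^ 2 / 4 : ℝ) : ℂ)) = (b * vecPot x 0 : ℂ) ^ 2 + (b * vecPot x 1) ^ 2 := by
    have := vecPot_sum_sq x
    have h : b ^ 2 * ‖x‖ ^ 2 / 4 = (b * vecPot x 0) ^ 2 + (b * vecPot x 1) ^ 2 := by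
      linear_combination (-b ^ 2) * this
    rw [h]; push_cast; ring
  have e2 : (((‖x‖ ^ 2 : ℝ) : ℂ)) = (x 0 : ℂ) ^ 2 + (x 1 : ℂ) ^ 2 := by
    rw [normSq_eq]; push_cast; ring
  have e3 : (vecPot x 0 : ℂ) * x 0 + vecPot x 1 * x 1 = 0 := by
    rw [vecPot_zero_apply, vecPot_one_apply]; push_cast; ring
  rw [e1, e2]
  push_cast
  linear_combination (4 * deriv F (‖x‖ ^ 2) + 4 * ((x 0 : ℂ) ^ 2 + (x 1 : ℂ) ^ 2)
    * deriv (deriv F) (‖x‖ ^ 2)) * Complex.I_mul_I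
    - (4 * b * Complex.I * deriv F (‖x‖ ^ 2)) * e3

/-- The oscillator applied to `exp (-lam s / 4) η(s)`. -/
theorem oscillator_gauss {η : ℝ → ℝ} (hη : ContDiff ℝ ∞ η) (lam s : ℝ)
    {F : ℝ → ℝ} (hF : F = fun s => Real.exp (-(lam * s / 4)) * η s) :
    -4 * deriv F s - 4 * s * deriv (deriv F) s + lam ^ 2 * s / 4 * F s
      = lam * F s - 4 * (Real.exp (lam * s / 4)
        * deriv (fun s => s * gaussWeight lam s * deriv η s) s) := by
  have hη' : ContDiff ℝ ∞ (deriv η) := (contDiff_infty_iff_deriv.1 hη).2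
  have d0 : ∀ s, HasDerivAt η (deriv η s) s := fun s =>
    (hη.differentiable (by norm_num) s).hasDerivAt
  have d1 : ∀ s, HasDerivAt (deriv η) (deriv (deriv η) s) s := fun s =>
    (hη'.differentiable (by norm_num) s).hasDerivAt
  have dE : ∀ s, HasDerivAt (fun s => Real.exp (-(lam * s / 4)))
      (Real.exp (-(lam * s / 4)) * -(lam / 4)) s := by
    intro s
    have : HasDerivAt (fun s : ℝ => -(lam * s / 4)) (-(lam / 4)) s := 
      (((hasDerivAt_id s).const_mul lam).div_const 4).neg.congr_deriv (by simp)
    exact this.exp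
  have dP : ∀ s, HasDerivAt (gaussWeight lam) (gaussWeight lam s * -(lam / 2)) s := by
    intro s
    have : HasDerivAt (fun s : ℝ => -(lam * s / 2)) (-(lam / 2)) s := 
      (((hasDerivAt_id s).const_mul lam).div_const 2).neg.congr_deriv (by simp)
    exact this.exp
  have f1 : ∀ s, HasDerivAt F (Real.exp (-(lam * s / 4)) * -(lam / 4) * η s
      + Real.exp (-(lam * s / 4)) * deriv η s) s := fun s => by
    rw [hF]; exact (dE s).mul (d0 s)
  have f1' : deriv F = fun s => Real.exp (-(lam * s / 4)) * -(lam / 4) * η s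
      + Real.exp (-(lam * s / 4)) * deriv η s := funext fun s => (f1 s).deriv
  have f2 := ((((dE s).mul_const (-(lam / 4))).mul (d0 s)).add ((dE s).mul (d1 s)))
  have f2' := (congrArg (fun k => deriv k s) f1').trans f2.deriv
  have f3 := ((((hasDerivAt_id s).mul (dP s)).mul (d1 s))).deriv
  have f3' : deriv (fun s => s * gaussWeight lam s * deriv η s) s = _ := f3
  rw [f2', f1', f3']
  have hg : Real.exp (lam * s / 4) * gaussWeight lam s = Real.exp (-(lam * s / 4)) := by
    rw [gaussWeight, ← Real.exp_add]; congr 1; ring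
  simp only [hF, id, Pi.mul_apply]
  linear_combination (4 * (deriv η s + s * (-(lam / 2)) * deriv η s + s * deriv (deriv η) s)) * hg

/-! ### The weak radial equation of a translated eigenfunction -/

theorem IsTest.memLp {χ : Plane → ℂ} (h : IsTest χ) : MemLp χ 2 volume :=
  h.1.continuous.memLp_of_hasCompactSupport h.2

/-- `translateTest` is the transpose of `magTranslate`, pointwise after the shift `x ↦ x - d`. -/
theorem magTranslate_sub (b : ℝ) (φ χ : Plane → ℂ) (d x : Plane) :
    φ (x - d) * translateTest b d χ (x - d) = magTranslate b φ d x * χ x := by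
  have h : inner ℝ (x - d) (vecPot d) = inner ℝ x (vecPot d) := by
    have : inner ℝ d (vecPot d) = 0 := by rw [inner_vecPot]; ring
    rw [inner_sub_left, this, sub_zero]
  rw [translateTest, magTranslate, h, sub_add_cancel]
  ring

/-- The translated eigenfunction is a weak solution of the radial equation, when tested against
radial functions `exp (-lam s / 4) η(s)` living where the translated well is radial. -/
theorem HamiltonianEq.weak_radial {lam e K M : ℝ} {v : Plane → ℝ} {φ : Plane → ℂ}
    (hφ : MemLp φ 2 volume) (h : HamiltonianEq lam lam v φ fun x => (e : ℂ) * φ x)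
    (hvm : Measurable v) (hvK : ∀ x, |v x| ≤ K) (d : Plane) {η : ℝ → ℝ} (hη : ContDiff ℝ ∞ η)
    (hM : ∀ s, M ≤ s → η s = 0) {V : ℝ → ℝ}
    (hV : ∀ x : Plane, ‖x‖ ^ 2 < M → V (‖x‖ ^ 2) = (lam - e + lam ^ 2 * v (x - d)) / 4) :
    ∫ x, magTranslate lam φ d x * ((Real.exp (lam * ‖x‖ ^ 2 / 4) *
      (-deriv (fun s => s * gaussWeight lam s * deriv η s) (‖x‖ ^ 2)
        + V (‖x‖ ^ 2) * gaussWeight lam (‖x‖ ^ 2) * η (‖x‖ ^ 2)) : ℝ) : ℂ) = 0 := by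
  set F : ℝ → ℝ := fun s => Real.exp (-(lam * s / 4)) * η s with hF
  have hFs : ContDiff ℝ ∞ F := by
    refine ContDiff.mul ?_ hη
    fun_prop
  set Fc : ℝ → ℂ := fun s => (F s : ℂ) with hFc
  have hFcs : ContDiff ℝ ∞ Fc := contDiff_ofReal.comp hFs
  have hFd : deriv Fc = fun s => ((deriv F s : ℝ) : ℂ) := funext fun s =>
    ((hFs.differentiable (by norm_num) s).hasDerivAt.ofReal_comp).deriv
  have hFs' : ContDiff ℝ ∞ (deriv F) := (contDiff_infty_iff_deriv.1 hFs).2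
  have hFdd : deriv (deriv Fc) = fun s => ((deriv (deriv F) s : ℝ) : ℂ) := by
    rw [hFd]
    exact funext fun s => ((hFs'.differentiable (by norm_num) s).hasDerivAt.ofReal_comp).deriv
  set χ : Plane → ℂ := fun x => Fc (‖x‖ ^ 2) with hχdef
  have hχ : IsTest χ := by
    refine ⟨hFcs.comp (contDiff_norm_sq ℝ), ?_⟩
    refine HasCompactSupport.of_support_subset_isCompact
      (isCompact_closedBall (0 : Plane) (Real.sqrt M)) fun x hx => ?_
    rw [mem_closedBall_zero_iff]
    refine Real.le_sqrt_of_sq_le ?_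
    by_contra hc
    exact hx (by simp [hχdef, hFc, hF, hM _ (not_le.1 hc).le])
  have hT : ∀ j, transposeMomentum lam j (transposeMomentum lam j (translateTest lam d χ))
      = translateTest lam d (transposeMomentum lam j (transposeMomentum lam j χ)) := by
    intro j
    rw [transposeMomentum_translateTest (hχ.1.differentiable (by norm_num)),
      transposeMomentum_translateTest
        ((hχ.transposeMomentum lam j).1.differentiable (by norm_num))]
  have hw := h.weak_eq (hχ.translateTest lam d)
  simp only [hT] at hw
  have i1 : ∀ j, Integrable fun x => φ x *
      translateTest lam d (transposeMomentum lam j (transposeMomentum lam j χ)) x := fun j =>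
    hφ.integrable_mul
      ((((hχ.transposeMomentum lam j).transposeMomentum lam j).translateTest lam d).memLp)
  have i2 : Integrable fun x => φ x * translateTest lam d χ x :=
    hφ.integrable_mul (hχ.translateTest lam d).memLp
  have i3 : Integrable fun x => ((lam ^ 2 * v x : ℝ) : ℂ) * φ x * translateTest lam d χ x := by
    have : Integrable fun x => ((lam ^ 2 * v x : ℝ) : ℂ) * (φ x * translateTest lam d χ x) := by
      refine i2.bdd_mul (c := lam ^ 2 * K)
        (Complex.measurable_ofReal.comp (hvm.const_mul _)).aestronglyMeasurable
        (.of_forall fun x => ?_)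
      rw [Complex.norm_real, norm_mul, Real.norm_of_nonneg (sq_nonneg _), Real.norm_eq_abs]
      exact mul_le_mul_of_nonneg_left (hvK x) (sq_nonneg _)
    simpa only [mul_assoc] using this
  have i4 : Integrable fun x => (e : ℂ) * φ x * translateTest lam d χ x := by
    simpa only [mul_assoc] using i2.const_mul (e : ℂ)
  have i5 : Integrable fun x => (∑ j, φ x *
      translateTest lam d (transposeMomentum lam j (transposeMomentum lam j χ)) x)
      + ((lam ^ 2 * v x : ℝ) : ℂ) * φ x * translateTest lam d χ x :=
    (integrable_finsetSum _ fun j _ => i1 j).add i3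
  rw [← integral_finsetSum _ fun j _ => i1 j,
    ← integral_add (integrable_finsetSum _ fun j _ => i1 j) i3, ← sub_eq_zero,
    ← integral_sub i5 i4,
    ← integral_sub_right_eq_self _ d] at hw
  have h4 : (4 : ℂ) ≠ 0 := by norm_num
  refine (mul_eq_zero_iff_left h4).1 ?_
  rw [← integral_const_mul, ← hw]
  congr 1; ext x
  have e1 : (∑ j, φ (x - d) * translateTest lam d
      (transposeMomentum lam j (transposeMomentum lam j χ)) (x - d))
      = magTranslate lam φ d x
        * ∑ j, transposeMomentum lam j (transposeMomentum lam j χ) x := by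
    rw [Finset.mul_sum]
    exact Finset.sum_congr rfl fun j _ => magTranslate_sub _ _ _ _ _
  have e2 := magTranslate_sub lam φ χ d x
  rw [e1, mul_assoc _ (φ (x - d)), e2, mul_assoc _ (φ (x - d)), e2, hχdef, sum_transposeMomentum_sq_radial hFcs, hFdd, hFd]
  have e3 := oscillator_gauss hη lam (‖x‖ ^ 2) hF
  -- beyond `M` both sides vanish, so the values of `V` there do not matter
  have e4 : F (‖x‖ ^ 2) * (lam - e + lam ^ 2 * v (x - d))
      = 4 * (Real.exp (lam * ‖x‖ ^ 2 / 4) *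
        (V (‖x‖ ^ 2) * (gaussWeight lam (‖x‖ ^ 2) * η (‖x‖ ^ 2)))) := by
    rcases lt_or_ge (‖x‖ ^ 2) M with hx | hx
    · have hg : Real.exp (lam * ‖x‖ ^ 2 / 4) * gaussWeight lam (‖x‖ ^ 2)
          = Real.exp (-(lam * ‖x‖ ^ 2 / 4)) := by
        rw [gaussWeight, ← Real.exp_add]; congr 1; ring
      rw [hV x hx]
      simp only [hF]
      linear_combination (-(lam - e + lam ^ 2 * v (x - d)) * η (‖x‖ ^ 2)) * hg
    · simp [hF, hM _ hx]
  have e5 : (-4 * deriv F (‖x‖ ^ 2) - 4 * (‖x‖ ^ 2) * deriv (deriv F) (‖x‖ ^ 2)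
      + lam ^ 2 * (‖x‖ ^ 2) / 4 * F (‖x‖ ^ 2)) + lam ^ 2 * v (x - d) * F (‖x‖ ^ 2)
      - e * F (‖x‖ ^ 2) = 4 * (Real.exp (lam * ‖x‖ ^ 2 / 4) *
      (-deriv (fun s => s * gaussWeight lam s * deriv η s) (‖x‖ ^ 2)
        + V (‖x‖ ^ 2) * (gaussWeight lam (‖x‖ ^ 2) * η (‖x‖ ^ 2)))) := by
    rw [e3]; linear_combination e4
  have e6 := congrArg (fun r : ℝ => (r : ℂ)) e5
  push_cast at e6 ⊢
  simp only [hFc]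
  linear_combination (-magTranslate lam φ d x) * e6

/-! ### The Gaussian trial function -/

theorem integrable_gauss {c : ℝ} (hc : 0 < c) :
    Integrable fun x : Plane => Real.exp (-(c * ‖x‖ ^ 2)) := by
  have h := (GaussianFourier.integrable_cexp_neg_mul_sq_norm_add (V := Plane) (b := (c : ℂ))
    (by simpa using hc) 0 0).norm
  refine h.congr (.of_forall fun x => ?_)
  simp only [zero_mul, add_zero, Complex.norm_exp]
  congr 1
  have : (-(c : ℂ) * (‖x‖ : ℂ) ^ 2) = ((-(c * ‖x‖ ^ 2) : ℝ) : ℂ) := by push_cast; ring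
  rw [this, Complex.ofReal_re]

theorem integrable_normSq_mul_gauss {c : ℝ} (hc : 0 < c) :
    Integrable fun x : Plane => ‖x‖ ^ 2 * Real.exp (-(c * ‖x‖ ^ 2)) := by
  refine ((integrable_gauss (half_pos hc)).const_mul (2 / c)).mono' (by fun_prop)
    (.of_forall fun x => ?_)
  rw [Real.norm_of_nonneg (by positivity)]
  have h1 : Real.exp (-(c * ‖x‖ ^ 2))
      = Real.exp (-(c / 2 * ‖x‖ ^ 2)) * Real.exp (-(c / 2 * ‖x‖ ^ 2)) := by
    rw [← Real.exp_add]; congr 1; ring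
  have h2 : (c / 2 * ‖x‖ ^ 2) * Real.exp (-(c / 2 * ‖x‖ ^ 2)) ≤ 1 := by
    have h3 := Real.add_one_le_exp (c / 2 * ‖x‖ ^ 2)
    rw [Real.exp_neg, ← div_eq_mul_inv, div_le_one (Real.exp_pos _)]
    linarith
  have h4 := mul_le_mul_of_nonneg_right h2 (Real.exp_pos (-(c / 2 * ‖x‖ ^ 2))).le
  rw [h1]
  calc ‖x‖ ^ 2 * (Real.exp (-(c / 2 * ‖x‖ ^ 2)) * Real.exp (-(c / 2 * ‖x‖ ^ 2)))
      = 2 / c * ((c / 2 * ‖x‖ ^ 2) * Real.exp (-(c / 2 * ‖x‖ ^ 2))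
        * Real.exp (-(c / 2 * ‖x‖ ^ 2))) := by field_simp
    _ ≤ _ := by
        rw [one_mul] at h4
        exact mul_le_mul_of_nonneg_left h4 (by positivity)

/-- The Gaussian `exp (-c |x|²)` as a complex function on the plane. -/
noncomputable def gaussian (c : ℝ) (x : Plane) : ℂ := ((Real.exp (-(c * ‖x‖ ^ 2)) : ℝ) : ℂ)

theorem contDiff_gaussian (c : ℝ) : ContDiff ℝ ∞ (gaussian c) := by
  refine contDiff_ofReal.comp (Real.contDiff_exp.comp ?_)
  exact (contDiff_const.mul (contDiff_norm_sq ℝ)).neg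

theorem fderiv_gaussian (c : ℝ) (j : Fin 2) (x : Plane) :
    fderiv ℝ (gaussian c) x (unitVec j) = -(2 * c * x j) * gaussian c x := by
  have hd : ∀ s : ℝ, HasDerivAt (fun s : ℝ => ((Real.exp (-(c * s)) : ℝ) : ℂ))
      ((Real.exp (-(c * s)) * -c : ℝ) : ℂ) s := by
    intro s
    have h : HasDerivAt (fun s : ℝ => -(c * s)) (-c) s :=
      (((hasDerivAt_id s).const_mul c).neg).congr_deriv (by simp)
    exact h.exp.ofReal_comp
  have h1 := hasDerivAt_normSq_line (F := fun s : ℝ => ((Real.exp (-(c * s)) : ℝ) : ℂ))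
    (fun s => (hd s).differentiableAt) x j
  rw [fderiv_eq_of_line ((contDiff_gaussian c).differentiable (by norm_num) x) h1, (hd _).deriv,
    gaussian]
  push_cast
  ring

theorem norm_coord_le (x : Plane) (j : Fin 2) : |x j| ≤ ‖x‖ := PiLp.norm_apply_le x j

/-- Second moments of a Gaussian, by integrating by parts against the coordinate function. -/
theorem integral_coord_sq_gauss {c : ℝ} (hc : 0 < c) (j : Fin 2) :
    2 * c * ∫ x : Plane, x j ^ 2 * Real.exp (-(c * ‖x‖ ^ 2))
      = ∫ x : Plane, Real.exp (-(c * ‖x‖ ^ 2)) := by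
  have hcoord : ∀ x : Plane, fderiv ℝ (fun x : Plane => ((x j : ℝ) : ℂ)) x (unitVec j) = 1 := by
    intro x
    refine fderiv_eq_of_line
      ((contDiff_ofReal.comp (contDiff_coord j)).differentiable (by norm_num) x) ?_
    simp only [coord_line]
    exact (((hasDerivAt_id (0 : ℝ)).const_add (x j)).ofReal_comp).congr_deriv (by simp)
  have i0 : Integrable fun x : Plane => gaussian c x := (integrable_gauss hc).ofReal
  have hmeas : Continuous fun x : Plane => ((x j : ℝ) : ℂ) :=
    (contDiff_ofReal.comp (contDiff_coord j)).continuous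
  have i2 : Integrable fun x : Plane => x j ^ 2 * Real.exp (-(c * ‖x‖ ^ 2)) := by
    refine (integrable_normSq_mul_gauss hc).mono' (by fun_prop) (.of_forall fun x => ?_)
    rw [Real.norm_of_nonneg (by positivity)]
    refine mul_le_mul_of_nonneg_right ?_ (Real.exp_pos _).le
    exact sq_le_sq' (by linarith [neg_le_of_abs_le (norm_coord_le x j)])
      (le_of_abs_le (norm_coord_le x j))
  have i1 : Integrable fun x : Plane => ((x j : ℝ) : ℂ) * gaussian c x := by
    refine ((integrable_gauss hc).add (integrable_normSq_mul_gauss hc)).mono'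
      (hmeas.mul (contDiff_gaussian c).continuous).aestronglyMeasurable (.of_forall fun x => ?_)
    rw [norm_mul, gaussian, Complex.norm_real, Complex.norm_real, Real.norm_eq_abs,
      Real.norm_of_nonneg (Real.exp_pos _).le]
    have h1 := norm_coord_le x j
    have h2 : |x j| ≤ 1 + ‖x‖ ^ 2 := by nlinarith [sq_nonneg (‖x‖ - 1), norm_nonneg x]
    have := mul_le_mul_of_nonneg_right h2 (Real.exp_pos (-(c * ‖x‖ ^ 2))).le
    simp only [Pi.add_apply]
    linarith
  have key := integral_mul_fderiv_eq_neg_fderiv_mul_of_integrable (μ := (volume : Measure Plane))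
    (f := fun x : Plane => ((x j : ℝ) : ℂ)) (g := gaussian c) (v := unitVec j)
    (by simpa [hcoord] using i0)
    (by
      have : Integrable fun x : Plane =>
          (-(2 * c) : ℂ) * ((x j ^ 2 * Real.exp (-(c * ‖x‖ ^ 2)) : ℝ) : ℂ) :=
        (i2.ofReal (𝕜 := ℂ)).const_mul (-(2 * c) : ℂ)
      refine this.congr (.of_forall fun x => ?_)
      simp only [fderiv_gaussian, gaussian]
      rw [Complex.ofReal_mul, Complex.ofReal_pow]; ring)
    i1
    (fun x _ => (contDiff_ofReal.comp (contDiff_coord j)).differentiable (by norm_num) x)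
    (fun x _ => (contDiff_gaussian c).differentiable (by norm_num) x)
  have e1 : ∫ x : Plane, ((x j : ℝ) : ℂ) * fderiv ℝ (gaussian c) x (unitVec j)
      = ((-(2 * c) * ∫ x : Plane, x j ^ 2 * Real.exp (-(c * ‖x‖ ^ 2)) : ℝ) : ℂ) := by
    rw [← integral_const_mul, ← integral_complex_ofReal]
    congr 1; ext x
    rw [fderiv_gaussian, gaussian, Complex.ofReal_mul, Complex.ofReal_mul, Complex.ofReal_pow]
    push_cast
    ring
  have e2 : ∫ x : Plane, fderiv ℝ (fun x : Plane => ((x j : ℝ) : ℂ)) x (unitVec j) * gaussian c x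
      = ((∫ x : Plane, Real.exp (-(c * ‖x‖ ^ 2)) : ℝ) : ℂ) := by
    rw [← integral_complex_ofReal]
    congr 1; ext x
    rw [hcoord, one_mul, gaussian]
  rw [e1, e2] at key
  have key' : -(2 * c) * ∫ x : Plane, x j ^ 2 * Real.exp (-(c * ‖x‖ ^ 2))
      = -∫ x : Plane, Real.exp (-(c * ‖x‖ ^ 2)) := by exact_mod_cast key
  linarith

/-- The magnetic gradient of the lowest Landau state `exp (-lam |x|² / 4)`. -/
noncomputable def landauGradient (lam : ℝ) (j : Fin 2) (x : Plane) : ℂ :=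
  (Complex.I * ((lam / 2 * x j : ℝ) : ℂ) - ((lam * vecPot x j : ℝ) : ℂ)) * gaussian (lam / 4) x

theorem normSq_landauGradient (lam : ℝ) (j : Fin 2) (x : Plane) :
    ‖landauGradient lam j x‖ ^ 2
      = (lam ^ 2 / 4 * x j ^ 2 + lam ^ 2 * vecPot x j ^ 2)
        * Real.exp (-(lam / 2 * ‖x‖ ^ 2)) := by
  rw [landauGradient, norm_mul, mul_pow, ← Complex.normSq_eq_norm_sq, ← Complex.normSq_eq_norm_sq,
    gaussian, Complex.normSq_ofReal, ← Real.exp_add, Complex.normSq_apply]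
  have : -(lam / 4 * ‖x‖ ^ 2) + -(lam / 4 * ‖x‖ ^ 2) = -(lam / 2 * ‖x‖ ^ 2) := by ring
  rw [this]
  simp
  ring

theorem gaussian_normSq (lam : ℝ) (x : Plane) :
    ‖gaussian (lam / 4) x‖ ^ 2 = Real.exp (-(lam / 2 * ‖x‖ ^ 2)) := by
  rw [gaussian, Complex.norm_real, Real.norm_of_nonneg (Real.exp_pos _).le, sq, ← Real.exp_add]
  congr 1; ring

theorem isMagneticGradient_gaussian {lam : ℝ} (hl : 0 < lam) :
    IsMagneticGradient lam (gaussian (lam / 4)) (landauGradient lam) := by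
  have hgc := (contDiff_gaussian (lam / 4)).continuous
  have hcoord : ∀ j, Continuous fun x : Plane => x j := fun j => (contDiff_coord j).continuous
  have hcont : ∀ j, Continuous (landauGradient lam j) := by
    intro j
    unfold landauGradient
    refine ((continuous_const.mul (Complex.continuous_ofReal.comp
      (continuous_const.mul (hcoord j)))).sub (Complex.continuous_ofReal.comp
      (continuous_const.mul (contDiff_vecPot j).continuous))).mul hgc
  refine ⟨?_, fun j => ?_, fun j χ hχ => ?_⟩
  · rw [memLp_two_iff_integrable_sq_norm hgc.aestronglyMeasurable]
    refine (integrable_gauss (half_pos hl)).congr (.of_forall fun x => ?_)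
    exact (gaussian_normSq lam x).symm
  · rw [memLp_two_iff_integrable_sq_norm (hcont j).aestronglyMeasurable]
    refine ((integrable_normSq_mul_gauss (half_pos hl)).const_mul (lam ^ 2 / 2)).mono'
      ((hcont j).norm.pow 2).aestronglyMeasurable (.of_forall fun x => ?_)
    rw [Real.norm_of_nonneg (by positivity), normSq_landauGradient, ← mul_assoc]
    refine mul_le_mul_of_nonneg_right ?_ (Real.exp_pos _).le
    have h1 := vecPot_sum_sq x
    have h2 : vecPot x j ^ 2 ≤ ‖x‖ ^ 2 / 4 := by
      rw [← h1]; fin_cases j <;> simp <;> positivity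
    have h3 : x j ^ 2 ≤ ‖x‖ ^ 2 := by
      rw [normSq_eq]; fin_cases j <;> simp <;> positivity
    nlinarith [sq_nonneg lam]
  · have hdc : Continuous fun x => fderiv ℝ χ x (unitVec j) :=
      ((hχ.1.fderiv_right (m := ∞) (by norm_num)).clm_apply contDiff_const).continuous
    have hdcs : HasCompactSupport fun x => fderiv ℝ χ x (unitVec j) :=
      hχ.2.fderiv_apply ℝ (unitVec j)
    have hci : ∀ {k l : Plane → ℂ}, Continuous k → Continuous l → HasCompactSupport l →
        Integrable fun x => k x * l x := fun hk hl' hc' =>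
      (hk.mul hl').integrable_of_hasCompactSupport (hc'.mul_left)
    have hdg : Continuous fun x => fderiv ℝ (gaussian (lam / 4)) x (unitVec j) :=
      (((contDiff_gaussian (lam / 4)).fderiv_right (m := ∞)
        (by norm_num)).clm_apply contDiff_const).continuous
    have ibp := integral_mul_fderiv_eq_neg_fderiv_mul_of_integrable
      (μ := (volume : Measure Plane)) (f := gaussian (lam / 4)) (g := χ) (v := unitVec j)
      (hci hdg hχ.1.continuous hχ.2) (hci hgc hdc hdcs) (hci hgc hχ.1.continuous hχ.2)
      (fun x _ => (contDiff_gaussian _).differentiable (by norm_num) x)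
      (fun x _ => hχ.1.differentiable (by norm_num) x)
    have hA : Continuous fun x : Plane => ((lam * vecPot x j : ℝ) : ℂ) * gaussian (lam / 4) x :=
      (Complex.continuous_ofReal.comp
        (continuous_const.mul (contDiff_vecPot j).continuous)).mul hgc
    have iA := hci hA hχ.1.continuous hχ.2
    have i1 := hci hdg hχ.1.continuous hχ.2
    have i2 := hci hgc hdc hdcs
    have e1 : ∫ x, landauGradient lam j x * χ x
        = -Complex.I * (∫ x, fderiv ℝ (gaussian (lam / 4)) x (unitVec j) * χ x)
          - ∫ x, ((lam * vecPot x j : ℝ) : ℂ) * gaussian (lam / 4) x * χ x := by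
      rw [← integral_const_mul, ← integral_sub (i1.const_mul _) iA]
      congr 1; ext x
      rw [landauGradient, fderiv_gaussian]; push_cast; ring
    have e2 : ∫ x, gaussian (lam / 4) x * transposeMomentum lam j χ x
        = Complex.I * (∫ x, gaussian (lam / 4) x * fderiv ℝ χ x (unitVec j))
          - ∫ x, ((lam * vecPot x j : ℝ) : ℂ) * gaussian (lam / 4) x * χ x := by
      rw [← integral_const_mul, ← integral_sub (i2.const_mul _) iA]
      congr 1; ext x
      rw [transposeMomentum]; ring
    rw [e1, e2, ibp]; ring

/-- The lowest Landau state as a trial function: the ground state energy lies strictly below the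
Landau level `lam`. -/
theorem IsGroundState.energy_lt {a lam e : ℝ} {v : Plane → ℝ} {φ : Plane → ℂ}
    (hv : IsAtomicWell a v) (hl : 0 < lam) (h : IsGroundState lam lam v e φ) : e < lam := by
  have hlow := h.lowest _ _ (isMagneticGradient_gaussian hl)
  have hl2 : 0 < lam / 2 := half_pos hl
  have ig := integrable_gauss hl2
  have hgrad := isMagneticGradient_gaussian hl
  set I : ℝ := ∫ x : Plane, Real.exp (-(lam / 2 * ‖x‖ ^ 2)) with hI
  have hIpos : 0 < I := integral_exp_pos ig
  have hkin : ∑ j, ∫ x, ‖landauGradient lam j x‖ ^ 2 = lam * I := by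
    have j2 : ∀ j : Fin 2, Integrable fun x : Plane =>
        x j ^ 2 * Real.exp (-(lam / 2 * ‖x‖ ^ 2)) := by
      intro j
      refine (integrable_normSq_mul_gauss hl2).mono' (by fun_prop) (.of_forall fun x => ?_)
      rw [Real.norm_of_nonneg (by positivity)]
      refine mul_le_mul_of_nonneg_right ?_ (Real.exp_pos _).le
      rw [normSq_eq]; fin_cases j <;> simp <;> positivity
    rw [← integral_finsetSum _ fun j _ =>
      (memLp_two_iff_integrable_sq_norm (hgrad.memLp_grad j).1).1 (hgrad.memLp_grad j)]
    have e1 : ∀ x : Plane, ∑ j, ‖landauGradient lam j x‖ ^ 2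
        = lam ^ 2 / 2 * (x 0 ^ 2 * Real.exp (-(lam / 2 * ‖x‖ ^ 2)))
          + lam ^ 2 / 2 * (x 1 ^ 2 * Real.exp (-(lam / 2 * ‖x‖ ^ 2))) := by
      intro x
      rw [Fin.sum_univ_two, normSq_landauGradient, normSq_landauGradient]
      have := vecPot_sum_sq x
      rw [normSq_eq x] at this
      linear_combination (lam ^ 2 * Real.exp (-(lam / 2 * ‖x‖ ^ 2))) * this
    simp only [e1]
    rw [integral_add ((j2 0).const_mul _) ((j2 1).const_mul _), integral_const_mul,
      integral_const_mul]
    have k0 := integral_coord_sq_gauss hl2 0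
    have k1 := integral_coord_sq_gauss hl2 1
    rw [← hI] at k0 k1
    linear_combination (lam / 2) * k0 + (lam / 2) * k1
  obtain ⟨K, hK⟩ := hv.bounded
  have iv : Integrable fun x => v x * Real.exp (-(lam / 2 * ‖x‖ ^ 2)) := by
    refine ig.bdd_mul (c := K) hv.measurable.aestronglyMeasurable (.of_forall fun x => ?_)
    rw [Real.norm_eq_abs, abs_of_nonpos (hv.nonpos x)]
    linarith [hK x]
  have hpot : ∫ x, v x * Real.exp (-(lam / 2 * ‖x‖ ^ 2)) < 0 := by
    have h0 : 0 < ∫ x, -(v x * Real.exp (-(lam / 2 * ‖x‖ ^ 2))) := by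
      have iv' : Integrable fun x => -(v x * Real.exp (-(lam / 2 * ‖x‖ ^ 2))) := iv.neg
      rw [integral_pos_iff_support_of_nonneg (fun x => ?_) iv']
      · have hs : Function.support (fun x => -(v x * Real.exp (-(lam / 2 * ‖x‖ ^ 2))))
            = Function.support v := by
          ext x; simp [Real.exp_ne_zero]
        rw [hs, pos_iff_ne_zero]
        intro h0
        refine hv.nontrivial ?_
        rw [Filter.EventuallyEq, ae_iff]
        exact h0
      · have := mul_nonneg (neg_nonneg.2 (hv.nonpos x)) (Real.exp_pos (-(lam / 2 * ‖x‖ ^ 2))).le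
        simp only [Pi.zero_apply]; linarith
    rw [integral_neg] at h0
    linarith
  simp only [energy, gaussian_normSq] at hlow
  rw [hkin, ← hI] at hlow
  have : lam ^ 2 * ∫ x, v x * Real.exp (-(lam / 2 * ‖x‖ ^ 2)) < 0 :=
    mul_neg_of_pos_of_neg (by positivity) hpot
  nlinarith

/-! ### Circular means of translated eigenfunctions -/

theorem RadialSolution.conjugate {lam S : ℝ} {V : ℝ → ℝ} {u Q : ℝ → ℂ}
    (h : RadialSolution lam V S u Q) :
    RadialSolution lam V S (fun s => conj (u s)) (fun s => conj (Q s)) := by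
  refine ⟨by simp [h.flux_zero], ?_, ?_⟩
  · convert! h.flux.conjugate using 2 with t
    rw [map_mul, Complex.conj_ofReal]
  · convert! h.value.conjugate using 2 with t
    rw [map_div₀, Complex.conj_ofReal]

theorem norm_magTranslate (b : ℝ) (φ : Plane → ℂ) (d x : Plane) :
    ‖magTranslate b φ d x‖ = ‖φ (x - d)‖ := by
  rw [magTranslate, norm_mul, mul_comm Complex.I, Complex.norm_exp_ofReal_mul_I, one_mul]

theorem memLp_magTranslate {φ : Plane → ℂ} (hφ : MemLp φ 2 volume) (b : ℝ) (d : Plane) :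
    MemLp (magTranslate b φ d) 2 volume := by
  have h1 := hφ.comp_measurePreserving (measurePreserving_sub_right volume d)
  refine h1.congr_norm ?_ (.of_forall fun x => ?_)
  · exact (contDiff_magneticPhase b d).continuous.aestronglyMeasurable.mul h1.1
  · rw [norm_magTranslate]; rfl

/-- The circular means of a translated eigenfunction solve the radial equation, as long as the
translated well is radial. -/
theorem exists_radialSolution_circleMean {lam e K K' : ℝ} {v : Plane → ℝ} {φ : Plane → ℂ}
    (hφ : MemLp φ 2 volume) (h : HamiltonianEq lam lam v φ fun x => (e : ℂ) * φ x)
    (hvm : Measurable v) (hvK : ∀ x, |v x| ≤ K) (d : Plane) {J : Set ℝ} (hJ : IsOpen J)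
    (hJ0 : J ⊆ Ioi 0) (hJl : ∀ s ∈ J, Ioc 0 s ⊆ J) {V : ℝ → ℝ} (hVm : Measurable V)
    (hVK : ∀ s, |V s| ≤ K')
    (hV : ∀ M ∈ J, ∀ x : Plane, ‖x‖ ^ 2 < M →
      V (‖x‖ ^ 2) = (lam - e + lam ^ 2 * v (x - d)) / 4)
    (hU : ∀ s ∈ J, MemLp (fun s => ((Real.exp (lam * s / 4) : ℝ) : ℂ)
      * circleMean (magTranslate lam φ d) s) 2 (volume.restrict (Ioc 0 s))) :
    ∃ u Q : ℝ → ℂ, (∀ᵐ s, s ∈ J → ((Real.exp (lam * s / 4) : ℝ) : ℂ)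
      * circleMean (magTranslate lam φ d) s = u s) ∧
      ∀ S ∈ J, RadialSolution lam V S u Q := by
  refine exists_radialSolution hJ hJ0 hJl hVm hVK hU ?_
  rintro η hη ⟨M, hMJ, hM⟩
  set D : ℝ → ℝ := deriv fun s => s * gaussWeight lam s * deriv η s with hD
  have hη' : ContDiff ℝ ∞ (deriv η) := (contDiff_infty_iff_deriv.1 hη).2
  have hDc : Continuous D :=
    ((contDiff_id.mul (contDiff_gaussWeight lam)).mul hη').continuous_deriv (by norm_num)
  have hη'0 : ∀ s, M < s → deriv η s = 0 := by
    intro s hs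
    have : η =ᶠ[𝓝 s] fun _ => 0 := by
      filter_upwards [Ioi_mem_nhds hs] with t ht using hM t (mem_Ioi.1 ht).le
    rw [this.deriv_eq]; simp
  have hD0 : ∀ s, M < s → D s = 0 := by
    intro s hs
    have : (fun s => s * gaussWeight lam s * deriv η s) =ᶠ[𝓝 s] fun _ => 0 := by
      filter_upwards [Ioi_mem_nhds hs] with t ht
      rw [hη'0 t ht, mul_zero]
    rw [hD, this.deriv_eq]; simp
  have hψ := memLp_magTranslate hφ lam d
  set ψ := magTranslate lam φ d
  have hcs : ∀ {k : ℝ → ℝ}, Continuous k → (∀ s, M < s → k s = 0) →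
      Integrable fun x => ψ x * ((k (‖x‖ ^ 2) : ℝ) : ℂ) := by
    intro k hk hk0
    suffices hm : MemLp (fun x : Plane => ((k (‖x‖ ^ 2) : ℝ) : ℂ)) 2 volume from
      hψ.integrable_mul hm
    refine Continuous.memLp_of_hasCompactSupport (by fun_prop) ?_
    refine HasCompactSupport.of_support_subset_isCompact
      (isCompact_closedBall (0 : Plane) (Real.sqrt M)) fun x hx => ?_
    rw [mem_closedBall_zero_iff]
    refine Real.le_sqrt_of_sq_le ?_
    by_contra hc
    exact hx (by simp [hk0 _ (not_le.1 hc)])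
  set H : ℝ → ℝ := fun s => Real.exp (lam * s / 4)
    * (-D s + V s * gaussWeight lam s * η s) with hH
  have hpc := continuous_gaussWeight lam
  have j1 := hcs (k := fun s => Real.exp (lam * s / 4) * -D s) (by fun_prop)
    (fun s hs => by rw [hD0 s hs]; simp)
  have j2 := hcs (k := fun s => Real.exp (lam * s / 4) * gaussWeight lam s * η s)
    (by have := hη.continuous; fun_prop) (fun s hs => by rw [hM s hs.le]; simp)
  have j3 : Integrable fun x : Plane => ((V (‖x‖ ^ 2) : ℝ) : ℂ) * (ψ x *
      ((Real.exp (lam * ‖x‖ ^ 2 / 4) * gaussWeight lam (‖x‖ ^ 2) * η (‖x‖ ^ 2) : ℝ) : ℂ)) := by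
    refine j2.bdd_mul (c := K') ?_ (.of_forall fun x => ?_)
    · exact (Complex.measurable_ofReal.comp (hVm.comp (by fun_prop))).aestronglyMeasurable
    · rw [Complex.norm_real]; exact hVK _
  have hi : Integrable fun x => ψ x * (fun s : ℝ => ((H s : ℝ) : ℂ)) (‖x‖ ^ 2) := by
    refine (j1.add j3).congr (.of_forall fun x => ?_)
    simp only [Pi.add_apply, hH]
    push_cast; ring
  have hw := h.weak_radial hφ hvm hvK d hη hM (hV M hMJ)
  have hr := integral_mul_radial (H := fun s : ℝ => ((H s : ℝ) : ℂ)) hi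
  have e0 : ∫ x, ψ x * (fun s : ℝ => ((H s : ℝ) : ℂ)) (‖x‖ ^ 2) = 0 := hw
  rw [e0, eq_comm, mul_eq_zero] at hr
  rcases hr with hr | hr
  · exact absurd (by exact_mod_cast hr) Real.pi_pos.ne'
  · rw [← hr]
    congr 1; ext s
    simp only [hH]
    push_cast; ring

/-! ### Ground states of radial wells -/

section Well

variable {a lam e : ℝ} {v : Plane → ℝ} {φ : Plane → ℂ}

/-- The radial profile of a radial well as a function of `s = |x|²`. -/
noncomputable def wellProfile (v : Plane → ℝ) (s : ℝ) : ℝ := v (Real.sqrt s • unitVec 0)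

theorem norm_unitVec (j : Fin 2) : ‖unitVec j‖ = 1 := by simp [unitVec]

theorem IsAtomicWell.eq_profile (hv : IsAtomicWell a v) (x : Plane) :
    v x = wellProfile v (‖x‖ ^ 2) := by
  obtain ⟨w, hw⟩ := hv.radial
  rw [wellProfile, hw, hw, norm_smul, norm_unitVec, Real.sqrt_sq (norm_nonneg x), mul_one,
    norm_norm]

theorem IsAtomicWell.eq_zero (hv : IsAtomicWell a v) {x : Plane} (hx : a < ‖x‖) : v x = 0 := by
  by_contra hc
  have := hv.support_subset hc
  rw [mem_closedBall_zero_iff] at this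
  exact absurd hx (not_lt.2 this)

theorem IsAtomicWell.profile_eq_zero (hv : IsAtomicWell a v) {s : ℝ} (hs : a ^ 2 < s) :
    wellProfile v s = 0 := by
  refine hv.eq_zero ?_
  rw [norm_smul, norm_unitVec, mul_one, Real.norm_of_nonneg (Real.sqrt_nonneg _)]
  exact Real.lt_sqrt_of_sq_lt hs

theorem IsAtomicWell.measurable_profile (hv : IsAtomicWell a v) : Measurable (wellProfile v) :=
  hv.measurable.comp (by fun_prop)

theorem IsAtomicWell.exists_abs_le (hv : IsAtomicWell a v) : ∃ K, ∀ x, |v x| ≤ K := by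
  obtain ⟨K, hK⟩ := hv.bounded
  exact ⟨K, fun x => by rw [abs_of_nonpos (hv.nonpos x)]; linarith [hK x]⟩

/-- The potential of the radial equation for the eigenvalue `e`. -/
noncomputable def radialPotential (lam e : ℝ) (v : Plane → ℝ) (s : ℝ) : ℝ :=
  (lam - e + lam ^ 2 * wellProfile v s) / 4

theorem IsAtomicWell.exists_abs_radialPotential_le (hv : IsAtomicWell a v) (lam e : ℝ) :
    ∃ K, ∀ s, |radialPotential lam e v s| ≤ K := by
  obtain ⟨K, hK⟩ := hv.exists_abs_le
  refine ⟨(|lam - e| + lam ^ 2 * K) / 4, fun s => ?_⟩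
  rw [radialPotential, abs_div, abs_of_pos (by norm_num : (0 : ℝ) < 4)]
  have h1 := abs_add_le (lam - e) (lam ^ 2 * wellProfile v s)
  rw [abs_mul, abs_of_nonneg (sq_nonneg lam)] at h1
  have h2 := mul_le_mul_of_nonneg_left (hK (Real.sqrt s • unitVec 0)) (sq_nonneg lam)
  have h3 : |wellProfile v s| = |v (Real.sqrt s • unitVec 0)| := rfl
  rw [h3] at h1
  linarith

theorem magTranslate_zero (b : ℝ) (φ : Plane → ℂ) : magTranslate b φ 0 = φ := by
  ext x
  have : inner ℝ x (vecPot 0) = 0 := by rw [inner_vecPot]; simp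
  rw [magTranslate, this]
  simp

theorem memLp_exp_mul {lam s : ℝ} {k : ℝ → ℂ} (hk : MemLp k 2 (volume.restrict (Ioc 0 s))) :
    MemLp (fun s => ((Real.exp (lam * s / 4) : ℝ) : ℂ) * k s) 2 (volume.restrict (Ioc 0 s)) := by
  have hc : Continuous fun s : ℝ => ((Real.exp (lam * s / 4) : ℝ) : ℂ) := by fun_prop
  obtain ⟨C, hC⟩ := isCompact_Icc.exists_bound_of_continuousOn (hc.continuousOn (s := Icc 0 s))
  refine MemLp.of_le_mul (c := C) hk (hc.aestronglyMeasurable.mul hk.1) ?_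
  refine (ae_restrict_iff' measurableSet_Ioc).2 (.of_forall fun t ht => ?_)
  rw [norm_mul]
  exact mul_le_mul_of_nonneg_right (hC t ⟨ht.1.le, ht.2⟩) (norm_nonneg _)

/-- A radial eigenfunction is `exp (-lam |x|² / 4) u(|x|²)` with `u` a regular solution of the
radial equation. -/
theorem IsGroundState.exists_profile (hv : IsAtomicWell a v)
    (h : IsGroundState lam lam v e φ) (hφ : MemLp φ 2 volume) (hr : IsRadial φ) :
    ∃ u Q : ℝ → ℂ, (∀ S, 0 ≤ S → RadialSolution lam (radialPotential lam e v) S u Q) ∧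
      (∀ᵐ x : Plane, φ x = ((Real.exp (-(lam * ‖x‖ ^ 2 / 4)) : ℝ) : ℂ) * u (‖x‖ ^ 2)) ∧
      IntegrableOn (fun s => gaussWeight lam s * ‖u s‖ ^ 2) (Ioi 0) ∧ ∃ s, 0 < s ∧ u s ≠ 0 := by
  obtain ⟨K, hK⟩ := hv.exists_abs_le
  obtain ⟨K', hK'⟩ := hv.exists_abs_radialPotential_le lam e
  have hsq := hr.integrableOn_circleMean_sq hφ
  have hmem : ∀ s, MemLp (circleMean φ) 2 (volume.restrict (Ioc 0 s)) := by
    intro s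
    have : MemLp (circleMean φ) 2 (volume.restrict (Ioi 0)) :=
      (memLp_two_iff_integrable_sq_norm (aestronglyMeasurable_circleMean hφ.1)).2 hsq
    exact this.mono_measure (Measure.restrict_mono Ioc_subset_Ioi_self le_rfl)
  have hex := exists_radialSolution_circleMean hφ h.eigen hv.measurable hK 0
    (J := Ioi 0) isOpen_Ioi subset_rfl (fun s _ => Ioc_subset_Ioi_self)
    (V := radialPotential lam e v)
    (((hv.measurable_profile.const_mul _).const_add _).div_const _) hK'
    (fun M _ x _ => by rw [sub_zero, hv.eq_profile x, radialPotential])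
    (fun s _ => by rw [magTranslate_zero]; exact memLp_exp_mul (hmem s))
  rw [magTranslate_zero] at hex
  obtain ⟨u, Q, hu, hsol⟩ := hex
  have hu' : ∀ᵐ s ∂volume.restrict (Ioi (0 : ℝ)),
      circleMean φ s = ((Real.exp (-(lam * s / 4)) : ℝ) : ℂ) * u s := by
    refine (ae_restrict_iff' measurableSet_Ioi).2 ?_
    filter_upwards [hu] with s hs hs0
    rw [← hs hs0, ← mul_assoc, ← Complex.ofReal_mul, ← Real.exp_add]
    simp
  have hφu : ∀ᵐ x : Plane, φ x = ((Real.exp (-(lam * ‖x‖ ^ 2 / 4)) : ℝ) : ℂ) * u (‖x‖ ^ 2) := by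
    filter_upwards [hr.ae_eq_circleMean, ae_normSq hu'] with x h1 h2
    rw [h1, h2]
  refine ⟨u, Q, fun S hS => ?_, hφu, ?_, ?_⟩
  · exact (hsol (S + 1) (mem_Ioi.2 (by linarith))).mono hS (by linarith)
  · refine hsq.congr ?_
    filter_upwards [hu'] with s hs
    rw [hs, norm_mul, Complex.norm_real, Real.norm_of_nonneg (Real.exp_pos _).le, mul_pow, sq,
      ← Real.exp_add, gaussWeight]
    congr 2; ring
  · by_contra hc
    push Not at hc
    have h0 : ∀ᵐ x : Plane, φ x = 0 := by
      have : ∀ᵐ s ∂volume.restrict (Ioi (0 : ℝ)), u s = 0 :=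
        (ae_restrict_iff' measurableSet_Ioi).2 (.of_forall fun s hs => hc s hs)
      filter_upwards [hφu, ae_normSq this] with x h1 h2
      rw [h1, h2, mul_zero]
    have h1 := h.normalized
    have h2 : ∀ᵐ x : Plane, ‖φ x‖ ^ 2 = (0 : ℝ) := by
      filter_upwards [h0] with x hx
      simp [hx]
    rw [integral_congr_ae h2] at h1
    simp at h1

/-- Addition theorem for the hopping coefficient. For `|d| > 2 a` the circular means of the
translated ground state over circles inside the well form a regular free solution `g`, normalized
by the value of the ground state at `-d`, and only this mean is seen by the hopping integral. -/
theorem hopping_eq_integral (hv : IsAtomicWell a v)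
    (heig : HamiltonianEq lam lam v φ fun x => (e : ℂ) * φ x) (hφ : MemLp φ 2 volume)
    {u Q : ℝ → ℂ} (hu : ∀ S, 0 ≤ S → RadialSolution lam (radialPotential lam e v) S u Q)
    (hφu : ∀ᵐ x : Plane, φ x = ((Real.exp (-(lam * ‖x‖ ^ 2 / 4)) : ℝ) : ℂ) * u (‖x‖ ^ 2))
    {d : Plane} (hd : 2 * a < ‖d‖) :
    ∃ g R : ℝ → ℂ, RadialSolution lam (fun _ => (lam - e) / 4) (a ^ 2) g R ∧
      g 0 = ((Real.exp (-(lam * ‖d‖ ^ 2 / 4)) : ℝ) : ℂ) * u (‖d‖ ^ 2) ∧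
      hopping lam lam v φ d = 4 * Real.pi * ∫ s in 0..a ^ 2,
        (((radialPotential lam e v s - (lam - e) / 4) * gaussWeight lam s : ℝ) : ℂ)
          * (conj (u s) * g s) := by
  have ha := hv.radius_pos
  obtain ⟨K, hK⟩ := hv.exists_abs_le
  set φc : Plane → ℂ := fun x => ((Real.exp (-(lam * ‖x‖ ^ 2 / 4)) : ℝ) : ℂ) * u (‖x‖ ^ 2)
    with hφc
  have hucont : ContinuousOn u (Ici 0) := by
    intro s hs
    have h1 := (hu (s + 1) (by linarith [mem_Ici.1 hs])).value.continuousOn s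
      ⟨hs, by linarith⟩
    refine h1.mono_of_mem_nhdsWithin ?_
    have : Iio (s + 1) ∈ 𝓝 s := Iio_mem_nhds (by linarith)
    filter_upwards [self_mem_nhdsWithin, mem_nhdsWithin_of_mem_nhds this] with t ht1 ht2
    exact ⟨ht1, (mem_Iio.1 ht2).le⟩
  have hφcc : Continuous φc := by
    refine Continuous.mul (by fun_prop) ?_
    exact hucont.comp_continuous (by fun_prop) fun x => mem_Ici.2 (sq_nonneg _)
  set ψ : Plane → ℂ := magTranslate lam φc d with hψ
  have hψc : Continuous ψ :=
    (contDiff_magneticPhase lam d).continuous.mul (hφcc.comp (continuous_id.sub continuous_const))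
  have hae : ∀ᵐ x, magTranslate lam φ d x = ψ x := by
    have := (measurePreserving_sub_right (volume : Measure Plane) d).quasiMeasurePreserving.ae hφu
    filter_upwards [this] with x hx
    simp only [hψ, magTranslate]
    rw [hx]
  have hφcm : MemLp φc 2 volume := (memLp_congr_ae hφu).1 hφ
  have heig' : HamiltonianEq lam lam v φc fun x => (e : ℂ) * φc x := by
    obtain ⟨-, g, hg, hw⟩ := heig
    refine ⟨hφcm.const_mul _, g, ⟨hφcm, hg.memLp_grad, fun j χ hχ => ?_⟩, fun χ hχ => ?_⟩
    · rw [hg.weak j χ hχ]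
      refine integral_congr_ae ?_
      filter_upwards [hφu] with x hx
      rw [hx]
    · have e1 : ∫ x, ((lam ^ 2 * v x : ℝ) : ℂ) * φc x * χ x
          = ∫ x, ((lam ^ 2 * v x : ℝ) : ℂ) * φ x * χ x := by
        refine integral_congr_ae ?_
        filter_upwards [hφu] with x hx
        rw [hx]
      have e2 : ∫ x, (e : ℂ) * φc x * χ x = ∫ x, (e : ℂ) * φ x * χ x := by
        refine integral_congr_ae ?_
        filter_upwards [hφu] with x hx
        rw [hx]
      rw [e1, e2, hw χ hχ]
  have hGc : Continuous (circleMean ψ) := continuous_circleMean hψc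
  set T : ℝ := (‖d‖ - a) ^ 2 with hT
  have haT : a ^ 2 < T := by
    rw [hT]; exact pow_lt_pow_left₀ (by linarith) ha.le two_ne_zero
  have ha2 : 0 < a ^ 2 := by positivity
  obtain ⟨g, R, hg, hsol⟩ := exists_radialSolution_circleMean hφcm heig' hv.measurable hK d
    (J := Ioo 0 T) isOpen_Ioo (fun s hs => hs.1) (fun s hs t ht => ⟨ht.1, ht.2.trans_lt hs.2⟩)
    (V := fun _ => (lam - e) / 4) measurable_const (fun _ => le_rfl)
    (fun M hM x hx => by
      have h1 : ‖x‖ < ‖d‖ - a := by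
        refine lt_of_pow_lt_pow_left₀ 2 (by linarith) ?_
        exact hx.trans hM.2
      have h2 : a < ‖x - d‖ := by
        have := norm_sub_norm_le d x
        rw [norm_sub_rev] at this
        linarith
      simp [hv.eq_zero h2])
    (fun s _ => memLp_exp_mul (by
      obtain ⟨C, hC⟩ := isCompact_Icc.exists_bound_of_continuousOn
        (hGc.continuousOn (s := Icc 0 s))
      refine MemLp.of_bound hGc.aestronglyMeasurable C ?_
      refine (ae_restrict_iff' measurableSet_Ioc).2 (.of_forall fun t ht => ?_)
      exact hC t ⟨ht.1.le, ht.2⟩))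
  have hgs := hsol (a ^ 2) ⟨ha2, haT⟩
  -- both sides are continuous, so they agree everywhere on `[0, a²]`
  have hgeq : EqOn (fun s => ((Real.exp (lam * s / 4) : ℝ) : ℂ) * circleMean ψ s) g
      (Icc 0 (a ^ 2)) := by
    refine Measure.eqOn_Icc_of_ae_eq volume ha2.ne ?_ ?_ hgs.value.continuousOn
    · have h1 : ∀ᵐ s ∂volume.restrict (Ioc 0 (a ^ 2)),
          ((Real.exp (lam * s / 4) : ℝ) : ℂ) * circleMean ψ s = g s := by
        refine (ae_restrict_iff' measurableSet_Ioc).2 ?_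
        filter_upwards [hg] with s hs hs'
        exact hs ⟨hs'.1, hs'.2.trans_lt haT⟩
      rw [← Measure.restrict_congr_set Ioc_ae_eq_Icc]
      exact h1
    · exact (Continuous.mul (by fun_prop) hGc).continuousOn
  refine ⟨g, R, hgs, ?_, ?_⟩
  · have := hgeq ⟨le_rfl, ha2.le⟩
    rw [← this]
    simp only [mul_zero, zero_div, Real.exp_zero, Complex.ofReal_one, one_mul]
    rw [circleMean_zero, hψ, magTranslate]
    simp [hφc]
  · set H : ℝ → ℂ := fun s => conj (u s) * ((Real.exp (-(lam * s / 4))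
      * (lam ^ 2 * wellProfile v s) : ℝ) : ℂ) with hH
    have e1 : hopping lam lam v φ d = ∫ x, ψ x * H (‖x‖ ^ 2) := by
      refine integral_congr_ae ?_
      filter_upwards [hφu, hae] with x h1 h2
      rw [h1, h2, map_mul, Complex.conj_ofReal, hv.eq_profile x]
      simp only [hH]
      push_cast; ring
    have hi : Integrable fun x => ψ x * H (‖x‖ ^ 2) := by
      have h1 : Integrable fun x => ψ x * conj (φc x) :=
        (memLp_magTranslate hφcm lam d).integrable_mul hφcm.star
      have h2 : Integrable fun x => ((lam ^ 2 * v x : ℝ) : ℂ) * (ψ x * conj (φc x)) := by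
        refine h1.bdd_mul (c := lam ^ 2 * K)
          (Complex.measurable_ofReal.comp (hv.measurable.const_mul _)).aestronglyMeasurable
          (.of_forall fun x => ?_)
        rw [Complex.norm_real, norm_mul, Real.norm_of_nonneg (sq_nonneg _), Real.norm_eq_abs]
        exact mul_le_mul_of_nonneg_left (hK x) (sq_nonneg _)
      refine h2.congr (.of_forall fun x => ?_)
      simp only [hφc, hH]
      rw [map_mul, Complex.conj_ofReal, hv.eq_profile x]
      push_cast; ring
    rw [e1, integral_mul_radial hi, mul_comm (4 : ℂ), mul_assoc,
      ← intervalIntegral.integral_const_mul, intervalIntegral.integral_of_le ha2.le]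
    congr 1
    rw [setIntegral_eq_of_subset_of_forall_sdiff_eq_zero measurableSet_Ioi
      (Ioc_subset_Ioi_self : Ioc 0 (a ^ 2) ⊆ Ioi 0)]
    · refine setIntegral_congr_fun measurableSet_Ioc fun s hs => ?_
      have h1 := hgeq ⟨hs.1.le, hs.2⟩
      simp only at h1 ⊢
      rw [← h1]
      have h2 : Real.exp (-(lam * s / 4)) = gaussWeight lam s * Real.exp (lam * s / 4) := by
        rw [gaussWeight, ← Real.exp_add]; congr 1; ring
      simp only [hH, radialPotential]
      rw [h2]
      push_cast; ring
    · intro s hs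
      have : a ^ 2 < s := by
        by_contra h'
        exact hs.2 ⟨hs.1, not_lt.1 h'⟩
      simp [hH, hv.profile_eq_zero this]

/-- Gaussian decay of the hopping coefficient with constant one. -/
theorem hopping_decay (hl : 0 < lam) (hv : IsAtomicWell a v)
    (h : IsGroundState lam lam v e φ) (hr : IsRadial φ) {d d' : Plane} (hd : 2 * a < ‖d‖)
    (hdd' : ‖d‖ ≤ ‖d'‖) :
    hopping lam lam v φ d ≠ 0 ∧ ‖hopping lam lam v φ d'‖
      ≤ Real.exp (-(1 / 4) * lam * (‖d'‖ ^ 2 - ‖d‖ ^ 2)) * ‖hopping lam lam v φ d‖ := by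
  have ha := hv.radius_pos
  have he := h.energy_lt hv hl
  have hφ : MemLp φ 2 volume := by
    obtain ⟨-, g, hg, -⟩ := h.eigen
    exact hg.memLp
  obtain ⟨u, Q, hu, hφu, hint, hne⟩ := h.exists_profile hv hφ hr
  obtain ⟨K, hK⟩ := hv.exists_abs_radialPotential_le lam e
  have ha2 : 0 < a ^ 2 := by positivity
  have hV₀ : 0 < (lam - e) / 4 := by linarith
  have hflux : ∀ s, a ^ 2 ≤ s → (conj (u s) * Q s).re < 0 := fun s hs =>
    energyFlux_neg hl hV₀ ha2
      (fun s hs => by rw [radialPotential, hv.profile_eq_zero hs]; ring) hK hu hint hne hs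
  have hu0 : ∀ s, a ^ 2 ≤ s → u s ≠ 0 := by
    intro s hs h0
    have := hflux s hs
    simp [h0] at this
  have had : a ^ 2 ≤ ‖d‖ ^ 2 := pow_le_pow_left₀ ha.le (by linarith) 2
  have hdd2 : ‖d‖ ^ 2 ≤ ‖d'‖ ^ 2 := pow_le_pow_left₀ (norm_nonneg d) hdd' 2
  obtain ⟨g, R, hg, hg0, hhop⟩ := hopping_eq_integral hv h.eigen hφ hu hφu hd
  obtain ⟨g', R', hg', hg0', hhop'⟩ := hopping_eq_integral hv h.eigen hφ hu hφu
    (hd.trans_le hdd')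
  have hexp : ∀ r : ℝ, ((Real.exp r : ℝ) : ℂ) ≠ 0 := fun r => by exact_mod_cast Real.exp_ne_zero r
  have hg0ne : g 0 ≠ 0 := by
    rw [hg0]; exact mul_ne_zero (hexp _) (hu0 _ had)
  have hmem : a ^ 2 ∈ Icc 0 (a ^ 2) := ⟨ha2.le, le_rfl⟩
  refine ⟨?_, ?_⟩
  · intro hzero
    rw [(hu (a ^ 2) ha2.le).conjugate.wronskian hg] at hhop
    rw [hhop, mul_eq_zero] at hzero
    have hpi : (4 * Real.pi : ℂ) ≠ 0 := by
      have := Real.pi_pos.ne'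
      exact_mod_cast mul_ne_zero four_ne_zero this
    have hW := hzero.resolve_left hpi
    -- a vanishing Wronskian would make the decaying and the regular solution proportional
    have hgne := hg.ne_zero_of_nonneg (fun _ => hV₀.le) hg0ne hmem
    have hgflux := hg.energyFlux_nonneg (fun _ => hV₀.le) hmem
    have huflux := hflux (a ^ 2) le_rfl
    set U := u (a ^ 2)
    set q := Q (a ^ 2)
    set G := g (a ^ 2)
    set r := R (a ^ 2)
    have e1 : (Complex.normSq G : ℂ) * conj (conj U * q) = (Complex.normSq U : ℂ) * (conj G * r) := by
      rw [← Complex.mul_conj, ← Complex.mul_conj, map_mul, Complex.conj_conj]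
      linear_combination (U * conj G) * hW
    have e2 := congrArg Complex.re e1
    rw [Complex.re_ofReal_mul, Complex.re_ofReal_mul, Complex.conj_re] at e2
    have h1 : 0 < Complex.normSq G := Complex.normSq_pos.2 hgne
    have h2 : 0 ≤ Complex.normSq U := Complex.normSq_nonneg U
    have h3 := mul_neg_of_pos_of_neg h1 huflux
    have h4 := mul_nonneg h2 hgflux
    linarith
  · have hprop : g 0 * hopping lam lam v φ d' = g' 0 * hopping lam lam v φ d := by
      rw [hhop, hhop', mul_left_comm, mul_left_comm (g' 0), ← intervalIntegral.integral_const_mul (g 0),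
        ← intervalIntegral.integral_const_mul (g' 0)]
      refine congrArg (fun z : ℂ => 4 * (Real.pi : ℂ) * z)
        (intervalIntegral.integral_congr fun s hs => ?_)
      rw [uIcc_of_le ha2.le] at hs
      have := hg'.proportional (fun _ => hV₀.le) hg hg0ne hs
      linear_combination ((((radialPotential lam e v s - (lam - e) / 4)
        * gaussWeight lam s : ℝ) : ℂ) * conj (u s)) * this
    have hmono : ‖u (‖d'‖ ^ 2)‖ ≤ ‖u (‖d‖ ^ 2)‖ := by
      have := (hu (‖d'‖ ^ 2) (sq_nonneg _)).normSq_ge (sq_nonneg ‖d‖) hdd2 le_rfl fun x hx =>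
        (hflux x (had.trans hx.1.le)).le
      exact (pow_le_pow_iff_left₀ (norm_nonneg _) (norm_nonneg _) two_ne_zero).1 this
    have hn := congrArg norm hprop
    rw [norm_mul, norm_mul, hg0, hg0', norm_mul, norm_mul, Complex.norm_real, Complex.norm_real,
      Real.norm_of_nonneg (Real.exp_pos _).le, Real.norm_of_nonneg (Real.exp_pos _).le] at hn
    have hupos : 0 < ‖u (‖d‖ ^ 2)‖ := norm_pos_iff.2 (hu0 (‖d‖ ^ 2) had)
    have hsplit : Real.exp (-(lam * ‖d'‖ ^ 2 / 4)) = Real.exp (-(lam * ‖d‖ ^ 2 / 4))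
        * Real.exp (-(1 / 4) * lam * (‖d'‖ ^ 2 - ‖d‖ ^ 2)) := by
      rw [← Real.exp_add]; congr 1; ring
    rw [hsplit] at hn
    refine le_of_mul_le_mul_left (a := Real.exp (-(lam * ‖d‖ ^ 2 / 4)) * ‖u (‖d‖ ^ 2)‖) ?_
      (mul_pos (Real.exp_pos _) hupos)
    rw [hn]
    calc _ ≤ Real.exp (-(lam * ‖d‖ ^ 2 / 4))
          * Real.exp (-(1 / 4) * lam * (‖d'‖ ^ 2 - ‖d‖ ^ 2)) * ‖u (‖d‖ ^ 2)‖
          * ‖hopping lam lam v φ d‖ := by gcongr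
      _ = _ := by ring

end Well

end MagneticWell

theorem theorem1p6 :
    ∃ C : ℝ, 0 < C ∧
      ∀ (a : ℝ) (v : MagneticWell.Plane → ℝ), MagneticWell.IsAtomicWell a v →
      ∀ (lam e : ℝ) (φ : MagneticWell.Plane → ℂ), 0 < lam →
        MagneticWell.IsGroundState lam lam v e φ → MagneticWell.IsRadial φ →
        (∀ d : MagneticWell.Plane, 2 * a < ‖d‖ →
          MagneticWell.hopping lam lam v φ d ≠ 0 ∧
          ∀ x : ℝ, 1 < x →
            ‖MagneticWell.hopping lam lam v φ (x • d) / MagneticWell.hopping lam lam v φ d‖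
              ≤ C * Real.exp (-(1 / 8) * lam * (x ^ 2 - 1) * ‖d‖ ^ 2)) ∧
        (∀ δ ξ : ℝ, 2 * a < δ → 0 ≤ ξ →
          ‖MagneticWell.hopping lam lam v φ ((δ + ξ) • MagneticWell.unitVec 0)‖
            ≤ C * Real.exp (-(1 / 8) * lam * (ξ ^ 2 + 2 * δ * ξ))
              * ‖MagneticWell.hopping lam lam v φ (δ • MagneticWell.unitVec 0)‖) := by
  refine ⟨1, one_pos, fun a v hv lam e φ hl h hr => ⟨fun d hd => ⟨?_, fun x hx => ?_⟩,
    fun δ ξ hδ hξ => ?_⟩⟩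
  · exact (MagneticWell.hopping_decay hl hv h hr hd le_rfl).1
  · have hx0 : 0 < x := by linarith
    have hn : ‖x • d‖ = x * ‖d‖ := by rw [norm_smul, Real.norm_of_nonneg hx0.le]
    obtain ⟨h0, hle⟩ := MagneticWell.hopping_decay hl hv h hr (d' := x • d) hd
      (by rw [hn]; exact le_mul_of_one_le_left (norm_nonneg d) hx.le)
    rw [norm_div, div_le_iff₀ (norm_pos_iff.2 h0), one_mul]
    refine hle.trans (mul_le_mul_of_nonneg_right (Real.exp_le_exp.2 ?_) (norm_nonneg _))
    rw [hn]
    have : 0 ≤ lam * ((x ^ 2 - 1) * ‖d‖ ^ 2) :=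
      mul_nonneg hl.le (mul_nonneg (by nlinarith) (sq_nonneg _))
    nlinarith
  · have ha := hv.radius_pos
    have hδ0 : 0 < δ := by linarith
    have hn : ∀ t : ℝ, 0 ≤ t → ‖t • MagneticWell.unitVec 0‖ = t := fun t ht => by
      rw [norm_smul, MagneticWell.norm_unitVec, mul_one, Real.norm_of_nonneg ht]
    obtain ⟨-, hle⟩ := MagneticWell.hopping_decay hl hv h hr
      (d := δ • MagneticWell.unitVec 0) (d' := (δ + ξ) • MagneticWell.unitVec 0)
      (by rw [hn δ hδ0.le]; exact hδ) (by rw [hn δ hδ0.le, hn _ (by linarith)]; linarith)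
    rw [one_mul]
    refine hle.trans (mul_le_mul_of_nonneg_right (Real.exp_le_exp.2 ?_) (norm_nonneg _))
    rw [hn δ hδ0.le, hn _ (by linarith)]
    have : 0 ≤ lam * (ξ ^ 2 + 2 * δ * ξ) := by positivity
    nlinarith
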